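/- Let $K$ be prefix-free Kolmogorov complexity of finite binary strings (with respect to any fixed optimal, i.e. additively universal, prefix-free machine $U$), and let $KC$ be the set of infinite binary sequences $\alpha=\alpha_0\alpha_1\alpha_2\dots$ for which there is a constant $k$ with $K(\alpha_0\cdots\alpha_{n-1})\ge n-k$ for all $n$. Let $g:(0,1)\to\mathbb{R}$ be the inverse of the Gaussian distribution function, i.e. $a=\frac{1}{\sqrt{2\pi}}\int_{-\infty}^{g(a)}e^{-t^2/2}\,dt$ for $a\in(0,1)$. Fix a computable bijection $\varphi:\omega^2\to\omega$. For a binary sequence $\alpha$ and $n\ge 0$ let $\beta_n\in[0,1]$ be the real number with binary digits $\alpha_{\varphi(n,0)}\alpha_{\varphi(n,1)}\alpha_{\varphi(n,2)}\dots$, put $\xi_n(\alpha)=g(\beta_n)$ (with an arbitrary value for $g$ at $0$ and $1$), and set $X_n=\xi_{2n}$, $Y_n=\xi_{2n+1}$ for $n\ge 0$. Then, for every $\alpha\in KC$, the Fourier–Wiener series $$W_\alpha(t)=X_0(\alpha)\,t+\sqrt2\sum_{n=1}^{\infty}\frac{1}{2\pi n}\bigl(X_n(\alpha)\sin 2\pi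 nt+Y_n(\alpha)(1-\cos 2\pi nt)\bigr)$$ converges uniformly on $[0,1]$ (as the limit of its ordinary partial sums) to a continuous function. -/

import Mathlib

/-! # Prefix-free Kolmogorov complexity

Binary strings are elements of `List Bool`, infinite binary sequences are functions `ℕ → Bool`.
The letter `1` is `true` and the letter `-1` (the binary digit `0`) is `false`. -/

namespace KCFourier

/-- A prefix-free machine: a partial computable function from binary strings to binary strings such
that no string of its domain is a proper initial segment of another string of its domain. -/
structure IsPrefixMachine (M : List Bool →. List Bool) : Prop where
  partrec : Partrec M
  prefixFree : ∀ p q : List Bool, (M p).Dom → (M q).Dom → p <+: q → p = q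

/-- The complexity of the string `x` with respect to the machine `M`: the least length of a program
`p` with `M p = x`, and `⊤` if there is none. -/
noncomputable def complexity (M : List Bool →. List Bool) (x : List Bool) : ℕ∞ :=
  ⨅ (p : List Bool) (_ : x ∈ M p), (p.length : ℕ∞)

/-- `U` is an optimal (additively universal) prefix-free machine: its complexity is minimal up to
an additive constant among all prefix-free machines. -/
structure IsOptimalMachine (U : List Bool →. List Bool) : Prop extends IsPrefixMachine U where
  optimal : ∀ M : List Bool →. List Bool, IsPrefixMachine M →
    ∃ c : ℕ, ∀ x : List Bool, complexity U x ≤ complexity M x + c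

/-- The initial segment `α₀ α₁ … αₙ₋₁` of length `n`. -/
def initSeg (α : ℕ → Bool) (n : ℕ) : List Bool := (List.range n).map α

/-- The set of Kolmogorov-Chaitin complex sequences: `∃ k, ∀ n, K(α₀ … αₙ₋₁) ≥ n - k`, where `K`
is the complexity with respect to the (optimal) machine `U`. -/
def KC (U : List Bool →. List Bool) : Set (ℕ → Bool) :=
  {α | ∃ k : ℕ, ∀ n : ℕ, (n : ℕ∞) ≤ complexity U (initSeg α n) + k}

/-! ### Existence of an optimal prefix-free machine -/

section Universal

open Nat.Partrec (Code)
open Nat.Partrec.Code Encodable Denumerable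

/-- By stage `s` the code `c` has been seen to halt on a string that is comparable with `r` and
different from `r`. -/
def Conflict (s : ℕ) (c : Code) (r : List Bool) : Prop :=
  ∃ n < s, (evaln s c n).isSome ∧ ((decode n : Option (List Bool)).getD r) ≠ r ∧
    (((decode n : Option (List Bool)).getD r).take r.length = r ∨
      r.take ((decode n : Option (List Bool)).getD r).length =
        (decode n : Option (List Bool)).getD r)

theorem Conflict.mono {s t : ℕ} {c : Code} {r : List Bool} (hst : s ≤ t) (h : Conflict s c r) :
    Conflict t c r := by
  obtain ⟨n, hn, h1, h2⟩ := h
  refine ⟨n, hn.trans_le hst, ?_, h2⟩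
  obtain ⟨v, hv⟩ := Option.isSome_iff_exists.1 h1
  exact Option.isSome_iff_exists.2 ⟨v, evaln_mono hst hv⟩

theorem primrecPred_conflict :
    PrimrecPred fun a : (ℕ × Code) × List Bool => Conflict a.1.1 a.1.2 a.2 := by
  have hq : Primrec fun x : ℕ × ((ℕ × Code) × List Bool) =>
      (decode x.1 : Option (List Bool)).getD x.2.2 :=
    Primrec.option_getD.comp (Primrec.decode.comp Primrec.fst) (Primrec.snd.comp Primrec.snd)
  have hr : Primrec fun x : ℕ × ((ℕ × Code) × List Bool) => x.2.2 :=
    Primrec.snd.comp Primrec.snd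
  have he : Primrec fun x : ℕ × ((ℕ × Code) × List Bool) => evaln x.2.1.1 x.2.1.2 x.1 :=
    primrec_evaln.comp (Primrec.pair (Primrec.fst.comp Primrec.snd) Primrec.fst)
  have h1 : PrimrecPred fun x : ℕ × ((ℕ × Code) × List Bool) =>
      ((evaln x.2.1.1 x.2.1.2 x.1).isSome = true) :=
    Primrec.eq.comp (Primrec.option_isSome.comp he) (Primrec.const true)
  have h2 : PrimrecPred fun x : ℕ × ((ℕ × Code) × List Bool) =>
      (decode x.1 : Option (List Bool)).getD x.2.2 ≠ x.2.2 :=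
    (Primrec.eq.comp hq hr).not
  have h3 : PrimrecPred fun x : ℕ × ((ℕ × Code) × List Bool) =>
      ((decode x.1 : Option (List Bool)).getD x.2.2).take x.2.2.length = x.2.2 :=
    Primrec.eq.comp (Primrec.list_take.comp (Primrec.list_length.comp hr) hq) hr
  have h4 : PrimrecPred fun x : ℕ × ((ℕ × Code) × List Bool) =>
      x.2.2.take ((decode x.1 : Option (List Bool)).getD x.2.2).length =
        (decode x.1 : Option (List Bool)).getD x.2.2 :=
    Primrec.eq.comp (Primrec.list_take.comp (Primrec.list_length.comp hq) hr) hq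
  have h : PrimrecRel fun (n : ℕ) (a : (ℕ × Code) × List Bool) =>
      (evaln a.1.1 a.1.2 n).isSome = true ∧ (decode n : Option (List Bool)).getD a.2 ≠ a.2 ∧
      (((decode n : Option (List Bool)).getD a.2).take a.2.length = a.2 ∨
        a.2.take ((decode n : Option (List Bool)).getD a.2).length =
          (decode n : Option (List Bool)).getD a.2) :=
    h1.and (h2.and (h3.or h4))
  have h5 := PrimrecRel.exists_mem_list h
  have h6 := h5.comp (Primrec.list_range.comp (Primrec.fst.comp Primrec.fst))
    (Primrec.id (α := (ℕ × Code) × List Bool))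
  exact h6.of_eq fun a => by simp [Conflict]

open Classical in
/-- The computation of the universal machine on the program `p = 0 ⋯ 0 1 r` (with `e` zeros) at
stage `s`: run the code number `e` on `r` unless a conflict has been seen. -/
noncomputable def univStep (p : List Bool) (s : ℕ) : Option (List Bool) :=
  if p.idxOf true < p.length ∧
      ¬ Conflict s (ofNat Code (p.idxOf true)) (p.drop (p.idxOf true + 1)) then
    (evaln s (ofNat Code (p.idxOf true)) (encode (p.drop (p.idxOf true + 1)))).bind decode
  else none

/-- A universal prefix-free machine. -/
noncomputable def univMachine (p : List Bool) : Part (List Bool) := Nat.rfindOpt (univStep p)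

theorem primrec_univStep : Primrec₂ univStep := by
  classical
  have he : Primrec fun x : List Bool × ℕ => x.1.idxOf true :=
    Primrec.list_idxOf.comp (Primrec.const true) Primrec.fst
  have hc : Primrec fun x : List Bool × ℕ => ofNat Code (x.1.idxOf true) :=
    (Primrec.ofNat Code).comp he
  have hr : Primrec fun x : List Bool × ℕ => x.1.drop (x.1.idxOf true + 1) :=
    Primrec.list_drop.comp (Primrec.succ.comp he) Primrec.fst
  have h1 : PrimrecPred fun x : List Bool × ℕ => x.1.idxOf true < x.1.length :=
    Primrec.nat_lt.comp he (Primrec.list_length.comp Primrec.fst)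
  have h2 : PrimrecPred fun x : List Bool × ℕ => ¬ Conflict x.2
      (ofNat Code (x.1.idxOf true)) (x.1.drop (x.1.idxOf true + 1)) :=
    (primrecPred_conflict.comp (Primrec.pair (Primrec.pair Primrec.snd hc) hr)).not
  have h3 : Primrec fun x : List Bool × ℕ =>
      (evaln x.2 (ofNat Code (x.1.idxOf true)) (encode (x.1.drop (x.1.idxOf true + 1)))).bind
        (fun v => (decode v : Option (List Bool))) :=
    Primrec.option_bind
      (primrec_evaln.comp (Primrec.pair (Primrec.pair Primrec.snd hc) (Primrec.encode.comp hr)))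
      (Primrec.decode.comp Primrec.snd)
  exact Primrec.ite (h1.and h2) h3 (Primrec.const none)

/-- Two comparable strings on which the universal machine halts are equal. -/
theorem univStep_prefixFree {p q : List Bool} {s t : ℕ} (hp : (univStep p s).isSome)
    (hq : (univStep q t).isSome) (h : p <+: q) : p = q := by
  obtain ⟨w, rfl⟩ := h
  have hp1 : p.idxOf true < p.length := by
    by_contra hh; simp [univStep, hh] at hp
  have hi : (p ++ w).idxOf true = p.idxOf true :=
    List.idxOf_append_of_mem (List.idxOf_lt_length_iff.1 hp1)
  have hd : (p ++ w).drop (p.idxOf true + 1) = p.drop (p.idxOf true + 1) ++ w :=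
    List.drop_append_of_le_length hp1
  unfold univStep at hp hq
  rw [hi, hd] at hq
  set e := p.idxOf true
  set c := ofNat Code e
  set r := p.drop (e + 1)
  by_cases hpc : e < p.length ∧ ¬ Conflict s c r
  swap
  · rw [if_neg hpc] at hp; simp at hp
  by_cases hqc : e < (p ++ w).length ∧ ¬ Conflict t c (r ++ w)
  swap
  · rw [if_neg hqc] at hq; simp at hq
  rw [if_pos hpc] at hp
  rw [if_pos hqc] at hq
  obtain ⟨v, hv⟩ : ∃ v, v ∈ evaln s c (encode r) := by
    cases hh : evaln s c (encode r) with
    | none => simp [hh] at hp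
    | some v => exact ⟨v, rfl⟩
  obtain ⟨u, hu⟩ : ∃ u, u ∈ evaln t c (encode (r ++ w)) := by
    cases hh : evaln t c (encode (r ++ w)) with
    | none => simp [hh] at hq
    | some v => exact ⟨v, rfl⟩
  by_contra hne
  have hw : w ≠ [] := by rintro rfl; simp at hne
  rcases le_total s t with hst | hst
  · refine hqc.2 ⟨encode r, (evaln_bound hv).trans_le hst, ?_, ?_, ?_⟩
    · exact Option.isSome_iff_exists.2 ⟨v, evaln_mono hst hv⟩
    · simpa using hw.symm
    · right; simp
  · refine hpc.2 ⟨encode (r ++ w), (evaln_bound hu).trans_le hst, ?_, ?_, ?_⟩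
    · exact Option.isSome_iff_exists.2 ⟨u, evaln_mono hst hu⟩
    · simpa using hw
    · left; simp

theorem isPrefixMachine_univMachine : IsPrefixMachine univMachine where
  partrec := Partrec.rfindOpt primrec_univStep.to_comp
  prefixFree p q hp hq h := by
    obtain ⟨s, a, ha⟩ := Nat.rfindOpt_dom.1 hp
    obtain ⟨t, b, hb⟩ := Nat.rfindOpt_dom.1 hq
    exact univStep_prefixFree (Option.isSome_iff_exists.2 ⟨a, ha⟩)
      (Option.isSome_iff_exists.2 ⟨b, hb⟩) h

theorem univMachine_simulates (M : List Bool →. List Bool) (hM : IsPrefixMachine M) :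
    ∃ e : ℕ, ∀ p x : List Bool, x ∈ M p →
      x ∈ univMachine (List.replicate e false ++ true :: p) := by
  obtain ⟨c, hc⟩ := Nat.Partrec.Code.exists_code.1 hM.partrec
  refine ⟨encode c, fun p x hx => ?_⟩
  have hi : (List.replicate (encode c) false ++ true :: p).idxOf true = encode c := by
    rw [List.idxOf_append_of_notMem (by simp)]; simp
  have hev : ∀ n v, v ∈ eval c n → ∃ q y, decode n = some q ∧ y ∈ M q ∧ encode y = v := by
    intro n v hv
    rw [hc] at hv
    simp only [Part.mem_bind_iff, Part.mem_map_iff, Part.mem_ofOption] at hv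
    obtain ⟨q, hq, y, hy, hyv⟩ := hv
    exact ⟨q, y, hq, hy, hyv⟩
  have hx' : encode x ∈ eval c (encode p) := by
    rw [hc]; simpa using hx
  have hd : (List.replicate (encode c) false ++ true :: p).drop (encode c + 1) = p := by
    rw [List.drop_append]; simp
  have hno : ∀ s, ¬ Conflict s c p := by
    rintro s ⟨n, -, h1, h2, h3⟩
    obtain ⟨v, hv⟩ := Option.isSome_iff_exists.1 h1
    obtain ⟨q, y, hq, hy, -⟩ := hev n v (evaln_sound hv)
    simp only [hq, Option.getD_some] at h2 h3
    rcases h3 with h3 | h3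
    · exact h2 (hM.prefixFree p q (Part.dom_iff_mem.2 ⟨x, hx⟩) (Part.dom_iff_mem.2 ⟨y, hy⟩)
        (h3 ▸ List.take_prefix _ _)).symm
    · exact h2 (hM.prefixFree q p (Part.dom_iff_mem.2 ⟨y, hy⟩) (Part.dom_iff_mem.2 ⟨x, hx⟩)
        (h3 ▸ List.take_prefix _ _))
  have hstep : ∀ s, univStep (List.replicate (encode c) false ++ true :: p) s =
      (evaln s c (encode p)).bind decode := by
    intro s
    unfold univStep
    rw [hi, hd, Denumerable.ofNat_encode, if_pos ⟨by simp, hno s⟩]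
  obtain ⟨s, hs⟩ := evaln_complete.1 hx'
  have hdom : (univMachine (List.replicate (encode c) false ++ true :: p)).Dom :=
    Nat.rfindOpt_dom.2 ⟨s, x, by rw [hstep, Option.mem_def.1 hs]; simp⟩
  obtain ⟨y, hy⟩ := Part.dom_iff_mem.1 hdom
  obtain ⟨t, ht⟩ := Nat.rfindOpt_spec hy
  rw [hstep] at ht
  obtain ⟨v, hv, hvy⟩ := Option.bind_eq_some_iff.1 ht
  have hvx : v = encode x := Part.mem_unique (evaln_sound hv) hx'
  rw [hvx] at hvy
  have : x = y := by simpa using hvy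
  exact this ▸ hy

/-- There is an optimal prefix-free machine. -/
theorem isOptimalMachine_univMachine : IsOptimalMachine univMachine where
  toIsPrefixMachine := isPrefixMachine_univMachine
  optimal M hM := by
    obtain ⟨e, he⟩ := univMachine_simulates M hM
    refine ⟨e + 1, fun x => ?_⟩
    by_cases hne : ∃ p, x ∈ M p
    · obtain ⟨p0, hp0⟩ := hne
      have : complexity M x + ((e + 1 : ℕ) : ℕ∞) =
          ⨅ p : {p // x ∈ M p}, ((p.1.length : ℕ∞) + ((e + 1 : ℕ) : ℕ∞)) := by
        have : Nonempty {p // x ∈ M p} := ⟨⟨p0, hp0⟩⟩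
        rw [complexity, iInf_subtype', ENat.iInf_add]
      rw [this]
      refine le_iInf fun p => ?_
      refine (iInf₂_le (f := fun (p : List Bool) (_ : x ∈ univMachine p) => (p.length : ℕ∞))
        _ (he p.1 x p.2)).trans (le_of_eq ?_)
      simp only [List.length_append, List.length_replicate, List.length_cons]
      push_cast
      ring
    · have : complexity M x = ⊤ := by
        simp only [complexity, iInf_eq_top]
        exact fun p hp => absurd ⟨p, hp⟩ hne
      simp [this]

end Universal

/-! # The Gaussian variables and the Fourier-Wiener series -/

/-- The Gaussian distribution function `x ↦ (2π)^(-1/2) ∫_{-∞}^x exp (-t²/2) dt`. -/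
noncomputable def gaussDF (x : ℝ) : ℝ :=
  (Real.sqrt (2 * Real.pi))⁻¹ * ∫ t in Set.Iic x, Real.exp (-t ^ 2 / 2)

/-- The inverse of the Gaussian distribution function on `(0,1)` (the value outside `(0,1)` is
arbitrary). -/
noncomputable def g (a : ℝ) : ℝ := Function.invFun gaussDF a

theorem gaussDF_eq (x : ℝ) :
    gaussDF x = (ProbabilityTheory.gaussianReal 0 1).real (Set.Iic x) := by
  rw [MeasureTheory.measureReal_def,
    ProbabilityTheory.gaussianReal_apply_eq_integral 0 one_ne_zero,
    ENNReal.toReal_ofReal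
      (MeasureTheory.integral_nonneg fun t => ProbabilityTheory.gaussianPDFReal_nonneg 0 1 t),
    gaussDF, ← MeasureTheory.integral_const_mul]
  simp [ProbabilityTheory.gaussianPDFReal]

/-- `g` is indeed a right inverse of the Gaussian distribution function on `(0,1)`. -/
theorem gaussDF_g {a : ℝ} (ha : a ∈ Set.Ioo (0 : ℝ) 1) : gaussDF (g a) = a := by
  refine Function.invFun_eq ?_
  have hc : gaussDF = fun x => ProbabilityTheory.cdf (ProbabilityTheory.gaussianReal 0 1) x := by
    funext x
    rw [gaussDF_eq, ProbabilityTheory.cdf_eq_real]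
  have hcont : Continuous gaussDF := by
    have hi : MeasureTheory.Integrable fun t : ℝ => Real.exp (-t ^ 2 / 2) := by
      have := integrable_exp_neg_mul_sq (b := 1 / 2) (by norm_num)
      refine this.congr (Filter.Eventually.of_forall fun t => ?_)
      ring_nf
    unfold gaussDF
    have : (fun x : ℝ => ∫ t in Set.Iic x, Real.exp (-t ^ 2 / 2)) = fun x =>
        (∫ t in Set.Iic (0 : ℝ), Real.exp (-t ^ 2 / 2)) + ∫ t in (0 : ℝ)..x,
          Real.exp (-t ^ 2 / 2) := by
      funext x
      rw [← intervalIntegral.integral_Iic_sub_Iic hi.integrableOn hi.integrableOn]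
      ring
    have h2 : Continuous fun x : ℝ => ∫ t in Set.Iic x, Real.exp (-t ^ 2 / 2) := by
      rw [this]
      exact continuous_const.add (intervalIntegral.continuous_primitive
        (fun _ _ => hi.intervalIntegrable) 0)
    exact continuous_const.mul h2
  refine mem_range_of_exists_le_of_exists_ge hcont ?_ ?_
  · have := ProbabilityTheory.tendsto_cdf_atBot (ProbabilityTheory.gaussianReal 0 1)
    rw [hc]
    exact ((this.eventually (gt_mem_nhds ha.1)).exists).imp fun _ h => h.le
  · have := ProbabilityTheory.tendsto_cdf_atTop (ProbabilityTheory.gaussianReal 0 1)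
    rw [hc]
    exact ((this.eventually (lt_mem_nhds ha.2)).exists).imp fun _ h => h.le

/-- The real number in `[0,1]` with binary expansion `0.b₀b₁b₂…`. -/
noncomputable def binaryReal (b : ℕ → Bool) : ℝ :=
  ∑' i : ℕ, (if b i then 1 else 0) * (1 / 2 : ℝ) ^ (i + 1)

/-- `ξₙ(α) = g(βₙ)`, where `βₙ` has the binary digits `α_{φ(n,0)} α_{φ(n,1)} α_{φ(n,2)} …`. -/
noncomputable def xi (φ : ℕ × ℕ → ℕ) (α : ℕ → Bool) (n : ℕ) : ℝ :=
  g (binaryReal fun i => α (φ (n, i)))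

/-- `Xₙ = ξ₂ₙ`. -/
noncomputable def X (φ : ℕ × ℕ → ℕ) (α : ℕ → Bool) (n : ℕ) : ℝ := xi φ α (2 * n)

/-- `Yₙ = ξ₂ₙ₊₁`. -/
noncomputable def Y (φ : ℕ × ℕ → ℕ) (α : ℕ → Bool) (n : ℕ) : ℝ := xi φ α (2 * n + 1)

/-- The partial sum
`X₀ t + √2 ∑_{1 ≤ n ≤ N} (2πn)⁻¹ (Xₙ sin 2πnt + Yₙ (1 - cos 2πnt))`
of the Fourier-Wiener series at `α`. -/
noncomputable def fourierWienerSum (φ : ℕ × ℕ → ℕ) (α : ℕ → Bool) (N : ℕ) (t : ℝ) : ℝ :=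
  X φ α 0 * t + Real.sqrt 2 * ∑ n ∈ Finset.Icc 1 N, 1 / (2 * Real.pi * n) *
    (X φ α n * Real.sin (2 * Real.pi * n * t) + Y φ α n * (1 - Real.cos (2 * Real.pi * n * t)))

end KCFourier

namespace KCFourier

/-! ## A computable test passed by every sequence in `KC` -/

section ComputableTest

open Encodable

theorem Computable.natCount {γ : Type*} [Primcodable γ] {p : γ → ℕ → Bool} (hp : Computable₂ p) :
    Computable₂ fun a n => Nat.count (fun x => p a x = true) n := by
  have h : Computable₂ fun (z : γ × ℕ) (y : ℕ × ℕ) => bif p z.1 y.1 then y.2 + 1 else y.2 :=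
    Computable.cond
      (hp.comp (Computable.fst.comp Computable.fst) (Computable.fst.comp Computable.snd))
      (Computable.succ.comp (Computable.snd.comp Computable.snd))
      (Computable.snd.comp Computable.snd)
  refine (Computable.nat_rec (f := fun z : γ × ℕ => z.2) (g := fun _ => 0)
    Computable.snd (Computable.const 0) h).of_eq ?_
  rintro ⟨a, n⟩
  induction n with
  | zero => simp
  | succ n ih =>
    simp only at ih
    simp only [Nat.count_succ, ← ih]
    by_cases hb : p a n = true <;> simp [hb]

/-- The number with binary digits `r`. -/
def binVal (r : List Bool) : ℕ := r.foldl (fun a b => 2 * a + b.toNat) 0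

theorem primrec_binVal : Primrec binVal := by
  refine Primrec.list_foldl (f := fun r : List Bool => r) (g := fun _ => 0)
    (h := fun _ z => 2 * z.1 + z.2.toNat) Primrec.id (Primrec.const 0) ?_
  refine Primrec.nat_add.comp (Primrec.nat_mul.comp (Primrec.const 2)
    (Primrec.fst.comp Primrec.snd)) ?_
  exact (Primrec.dom_finite Bool.toNat).comp (Primrec.snd.comp Primrec.snd)

theorem exists_binVal_eq (t v : ℕ) (hv : v < 2 ^ t) : ∃ r : List Bool, r.length = t ∧ binVal r = v := by
  induction t generalizing v with
  | zero => exact ⟨[], rfl, by simp [binVal] at hv ⊢; omega⟩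
  | succ t ih =>
    obtain ⟨r, hr, hrv⟩ := ih (v / 2) (by rw [pow_succ] at hv; omega)
    refine ⟨r ++ [decide (v % 2 = 1)], by simp [hr], ?_⟩
    simp only [binVal, List.foldl_append, List.foldl_cons, List.foldl_nil] at hrv ⊢
    rw [hrv]
    by_cases h : v % 2 = 1 <;> simp [h] <;> omega

variable (E : ℕ → ℕ → Bool) (len : ℕ → ℕ)

/-- The string with code `x`. -/
def decodeString (x : ℕ) : List Bool := (decode x : Option (List Bool)).getD []

/-- On the program `0 ⋯ 0 1 r` with `m` zeros, stage `s` of the machine checks that `s` is the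
`binVal r`-th element of the set with characteristic function `E m`. -/
def listingStep (p : List Bool) (s : ℕ) : Option (List Bool) :=
  bif decide (p.length = p.idxOf true + 1 + len (p.idxOf true)) && (E (p.idxOf true) s &&
      decide (Nat.count (fun x => E (p.idxOf true) x = true) s
        = binVal (p.drop (p.idxOf true + 1)))) then
    some (decodeString s) else none

/-- The machine listing the elements of the sets `E m`. -/
def listingMachine (p : List Bool) : Part (List Bool) := Nat.rfindOpt (listingStep E len p)

variable {E len}

theorem computable_listingStep (hE : Computable₂ E) (hlen : Computable len) :
    Computable₂ (listingStep E len) := by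
  have he : Computable fun x : List Bool × ℕ => x.1.idxOf true :=
    (Primrec.list_idxOf.comp (Primrec.const true) Primrec.fst).to_comp
  have h1 : Computable fun x : List Bool × ℕ =>
      decide (x.1.length = x.1.idxOf true + 1 + len (x.1.idxOf true)) :=
    (Primrec.eq.decide.to_comp).comp (Computable.list_length.comp Computable.fst)
      (Primrec.nat_add.to_comp.comp (Computable.succ.comp he) (hlen.comp he))
  have h2 : Computable fun x : List Bool × ℕ => E (x.1.idxOf true) x.2 := hE.comp he Computable.snd
  have h3 : Computable fun x : List Bool × ℕ =>
      decide (Nat.count (fun y => E (x.1.idxOf true) y = true) x.2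
        = binVal (x.1.drop (x.1.idxOf true + 1))) :=
    (Primrec.eq.decide.to_comp).comp ((Computable.natCount hE).comp he Computable.snd)
      (primrec_binVal.to_comp.comp
        (Primrec.list_drop.to_comp.comp (Computable.succ.comp he) Computable.fst))
  have h4 : Computable fun x : List Bool × ℕ => decodeString x.2 :=
    (Primrec.option_getD.comp (Primrec.decode.comp Primrec.snd) (Primrec.const [])).to_comp
  exact Computable.cond (Primrec.and.to_comp.comp h1 (Primrec.and.to_comp.comp h2 h3))
    (Computable.option_some.comp h4) (Computable.const none)

theorem length_of_listingMachine_dom {p : List Bool} (hp : (listingMachine E len p).Dom) :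
    p.length = p.idxOf true + 1 + len (p.idxOf true) := by
  obtain ⟨s, a, ha⟩ := Nat.rfindOpt_dom.1 hp
  by_contra h
  simp [listingStep, h] at ha

theorem isPrefixMachine_listingMachine (hE : Computable₂ E) (hlen : Computable len) :
    IsPrefixMachine (listingMachine E len) where
  partrec := Partrec.rfindOpt (computable_listingStep hE hlen)
  prefixFree p q hp hq h := by
    have h1 := length_of_listingMachine_dom hp
    have h2 := length_of_listingMachine_dom hq
    refine h.eq_of_length ?_
    obtain ⟨w, rfl⟩ := h
    have hi : (p ++ w).idxOf true = p.idxOf true :=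
      List.idxOf_append_of_mem (List.idxOf_lt_length_iff.1 (by omega))
    rw [h1, h2, hi]

theorem complexity_listingMachine_le (m : ℕ) {S : Finset ℕ} (hS : ∀ x, E m x = true ↔ x ∈ S)
    (hcard : S.card ≤ 2 ^ len m) {x : List Bool} (hx : E m (encode x) = true) :
    complexity (listingMachine E len) x ≤ ((m + 1 + len m : ℕ) : ℕ∞) := by
  have hlt : Nat.count (fun y => E m y = true) (encode x) < 2 ^ len m := by
    refine lt_of_lt_of_le ?_ hcard
    rw [Nat.count_eq_card_filter_range]
    refine Finset.card_lt_card ⟨fun y hy => (hS y).1 (Finset.mem_filter.1 hy).2, fun h => ?_⟩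
    have := h ((hS _).1 hx)
    simp at this
  obtain ⟨r, hr, hrv⟩ := exists_binVal_eq _ _ hlt
  have hi : (List.replicate m false ++ true :: r).idxOf true = m := by
    rw [List.idxOf_append_of_notMem (by simp)]; simp
  have hd : (List.replicate m false ++ true :: r).drop (m + 1) = r := by
    rw [List.drop_append]; simp
  have hstep : ∀ s, listingStep E len (List.replicate m false ++ true :: r) s =
      bif E m s && decide (Nat.count (fun y => E m y = true) s =
        Nat.count (fun y => E m y = true) (encode x)) then some (decodeString s) else none := by
    intro s
    unfold listingStep
    rw [hi, hd, hrv]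
    simp [hr, add_comm, add_left_comm]
  have hdom : (listingMachine E len (List.replicate m false ++ true :: r)).Dom :=
    Nat.rfindOpt_dom.2 ⟨encode x, x, by rw [hstep]; simp [hx, decodeString]⟩
  obtain ⟨y, hy⟩ := Part.dom_iff_mem.1 hdom
  obtain ⟨s, hs⟩ := Nat.rfindOpt_spec hy
  rw [hstep] at hs
  have hys : E m s = true ∧ Nat.count (fun y => E m y = true) s =
      Nat.count (fun y => E m y = true) (encode x) := by
    by_contra hcon
    have : (E m s && decide (Nat.count (fun y => E m y = true) s =
        Nat.count (fun y => E m y = true) (encode x))) = false := by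
      simpa [not_and] using hcon
    rw [this] at hs
    simp at hs
  have hsx : s = encode x := Nat.count_injective hys.1 hx hys.2
  have hyx : y = x := by
    rw [hsx] at hs
    have hb : (some x : Option (List Bool)) = some y := by simpa [hx, decodeString] using hs
    exact (Option.some.inj hb).symm
  rw [hyx] at hy
  refine (iInf₂_le (f := fun (p : List Bool) (_ : x ∈ listingMachine E len p) =>
    (p.length : ℕ∞)) _ hy).trans (le_of_eq ?_)
  simp only [List.length_append, List.length_replicate, List.length_cons, hr]
  push_cast
  ring

theorem length_initSeg (α : ℕ → Bool) (n : ℕ) : (initSeg α n).length = n := by simp [initSeg]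

/-- If the `m`-th set of a uniformly computable family of sets of strings of length `ℓ m` has
measure at most `2⁻²ᵐ`, then an element of `KC` has initial segments in finitely many of them. -/
theorem eventually_not_mem_of_mem_KC {U : List Bool →. List Bool} (hU : IsOptimalMachine U)
    {α : ℕ → Bool} (hα : α ∈ KC U) {B : ℕ → List Bool → Bool} (hB : Computable₂ B)
    {ℓ : ℕ → ℕ} (hℓ : Computable ℓ)
    (hcard : ∀ᶠ m in Filter.atTop,
      2 ^ (2 * m) * (Finset.univ.filter fun σ : Fin (ℓ m) → Bool => B m (List.ofFn σ)).card
        ≤ 2 ^ ℓ m) :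
    ∀ᶠ m in Filter.atTop, B m (initSeg α (ℓ m)) = false := by
  classical
  set E : ℕ → ℕ → Bool := fun m x =>
    decide (encode (decodeString x) = x) &&
      (decide ((decodeString x).length = ℓ m) && B m (decodeString x)) with hEdef
  have hds : Computable fun x : ℕ × ℕ => decodeString x.2 :=
    (Primrec.option_getD.comp (Primrec.decode.comp Primrec.snd) (Primrec.const [])).to_comp
  have hE : Computable₂ E := by
    refine Primrec.and.to_comp.comp ?_ (Primrec.and.to_comp.comp ?_ (hB.comp Computable.fst hds))
    · exact Primrec.eq.decide.to_comp.comp (Computable.encode.comp hds) Computable.snd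
    · exact Primrec.eq.decide.to_comp.comp (Computable.list_length.comp hds)
        (hℓ.comp Computable.fst)
  have hlen : Computable fun m => ℓ m - 2 * m :=
    Primrec.nat_sub.to_comp.comp hℓ
      (Primrec.nat_mul.to_comp.comp (Computable.const 2) Computable.id)
  obtain ⟨c, hc⟩ := hU.optimal _ (isPrefixMachine_listingMachine hE hlen)
  obtain ⟨k, hk⟩ := hα
  filter_upwards [hcard, Filter.eventually_gt_atTop (1 + c + k)] with m hm hmk
  by_contra hbad
  rw [Bool.not_eq_false] at hbad
  set T := Finset.univ.filter fun σ : Fin (ℓ m) → Bool => B m (List.ofFn σ) with hT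
  have hmemT : ∀ x : List Bool, x.length = ℓ m → B m x = true →
      ∃ σ ∈ T, List.ofFn σ = x := by
    intro x hx hBx
    refine ⟨fun i => x.get (Fin.cast hx.symm i), ?_, ?_⟩
    · have : List.ofFn (fun i => x.get (Fin.cast hx.symm i)) = x := by
        apply List.ext_getElem <;> simp [hx]
      simp only [hT, Finset.mem_filter, Finset.mem_univ, true_and, this, hBx]
    · apply List.ext_getElem <;> simp [hx]
  have hTpos : 0 < T.card := by
    obtain ⟨σ, hσ, -⟩ := hmemT _ (length_initSeg α (ℓ m)) hbad
    exact Finset.card_pos.2 ⟨σ, hσ⟩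
  have h2m : 2 * m ≤ ℓ m := by
    have : 2 ^ (2 * m) ≤ 2 ^ ℓ m := le_trans (Nat.le_mul_of_pos_right _ hTpos) hm
    exact (Nat.pow_le_pow_iff_right (by norm_num)).1 this
  have hTc : T.card ≤ 2 ^ (ℓ m - 2 * m) := by
    have hpow : 2 ^ ℓ m = 2 ^ (2 * m) * 2 ^ (ℓ m - 2 * m) := by
      rw [← pow_add, Nat.add_sub_cancel' h2m]
    rw [hpow] at hm
    exact Nat.le_of_mul_le_mul_left hm (by positivity)
  have hcomp := complexity_listingMachine_le (E := E) (len := fun m => ℓ m - 2 * m) m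
    (S := T.image fun σ => encode (List.ofFn σ)) (x := initSeg α (ℓ m)) ?_
    (Finset.card_image_le.trans hTc) ?_
  · have h := (hk (ℓ m)).trans (add_le_add_left ((hc _).trans (add_le_add_left hcomp _)) _)
    have h' : ℓ m ≤ m + 1 + (ℓ m - 2 * m) + c + k := by exact_mod_cast h
    omega
  · intro x
    simp only [hEdef, Finset.mem_image]
    constructor
    · intro hx
      simp only [Bool.and_eq_true, decide_eq_true_eq] at hx
      obtain ⟨hx1, hx2, hx3⟩ := hx
      obtain ⟨σ, hσ, hσy⟩ := hmemT _ hx2 hx3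
      exact ⟨σ, hσ, by rw [hσy, hx1]⟩
    · rintro ⟨σ, hσ, rfl⟩
      have hσB : B m (List.ofFn σ) = true := (Finset.mem_filter.1 hσ).2
      simp [decodeString, hσB]
  · simp [hEdef, decodeString, hbad, length_initSeg]

end ComputableTest

/-! ## The correlation test -/

section CorrelationTest

theorem PrimrecPred.existsLt {γ : Type} [Primcodable γ] {p : γ → ℕ → Prop} {f : γ → ℕ}
    (hf : Primrec f) (hp : PrimrecPred fun z : γ × ℕ => p z.1 z.2) :
    PrimrecPred fun a => ∃ x < f a, p a x := by
  have hp' : PrimrecRel fun (x : ℕ) (a : γ) => p a x :=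
    hp.comp (Primrec.pair Primrec.snd Primrec.fst)
  exact ((PrimrecRel.exists_mem_list hp').comp (Primrec.list_range.comp hf)
    Primrec.id).of_eq (by simp)

theorem primrec_boundedCount {γ : Type*} [Primcodable γ] {p : γ × ℕ → Prop} [DecidablePred p]
    (hp : PrimrecPred p) {f : γ → ℕ} (hf : Primrec f) :
    Primrec fun a => Nat.count (fun n => p (a, n)) (f a) := by
  have hp' : PrimrecPred fun z : γ × (ℕ × ℕ) => p (z.1, z.2.1) :=
    hp.comp (Primrec.pair Primrec.fst (Primrec.fst.comp Primrec.snd))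
  have h : Primrec₂ fun (z : γ) (y : ℕ × ℕ) => if p (z, y.1) then y.2 + 1 else y.2 :=
    Primrec.ite hp' (Primrec.succ.comp (Primrec.snd.comp Primrec.snd))
      (Primrec.snd.comp Primrec.snd)
  refine (Primrec.nat_rec' (f := f) (g := fun _ => 0) hf (Primrec.const 0) h).of_eq ?_
  intro a
  generalize f a = n
  induction n with
  | zero => simp
  | succ n ih =>
    simp only [Nat.count_succ, ← ih]
    split_ifs <;> simp

theorem primrec_natPow : Primrec₂ fun a n : ℕ => a ^ n := by
  have h : Primrec₂ fun (z : ℕ × ℕ) (y : ℕ × ℕ) => y.2 * z.1 :=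
    Primrec.nat_mul.comp (Primrec.snd.comp Primrec.snd) (Primrec.fst.comp Primrec.fst)
  refine (Primrec.nat_rec' (f := fun z : ℕ × ℕ => z.2) (g := fun _ => 1) Primrec.snd
    (Primrec.const 1) h).of_eq ?_
  rintro ⟨a, n⟩
  induction n with
  | zero => simp
  | succ n ih => simp only at ih ⊢; rw [pow_succ, ih]

/-- The number with binary digits `b 0, …, b (L - 1)`. -/
def blockVal (b : ℕ → Bool) : ℕ → ℕ
  | 0 => 0
  | L + 1 => 2 * blockVal b L + (b L).toNat

/-- For `k < K`: `1` if `k` is one of the last `v` numbers below `K`, `-1` if it is one of the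
first `v`. -/
def tailSign (K v k : ℕ) : ℤ := (if K ≤ k + v then 1 else 0) - (if k < v then 1 else 0)

/-- The correlation at distance `h` of the tail signs of the `κ n`, `n ≡ c (mod 2)`. -/
def correlation (K v c h : ℕ) (κ : ℕ → ℕ) (M : ℕ) : ℤ :=
  ∑ n ∈ Finset.range M, tailSign K v (κ (2 * n + c)) * tailSign K v (κ (2 * (n + h) + c))

/-- At level `m`, the numbers `κ n < 2 ^ (4 * m)` come too close to the ends or are too
correlated. -/
def IsBad (m : ℕ) (κ : ℕ → ℕ) : Prop :=
  (∃ n < 4 * m ^ 16, κ n < 2 ^ m ∨ 2 ^ (4 * m) ≤ κ n + 2 ^ m) ∨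
  ∃ c < 2, ∃ h < m ^ 16 + 1, ∃ M < m ^ 16 + 1, ∃ v < 2 ^ (4 * m),
    1 ≤ h ∧ (m : ℤ) ^ 10 ≤ |correlation (2 ^ (4 * m)) v c h κ M|

theorem correlation_eq_count (K v c h : ℕ) (κ : ℕ → ℕ) (M : ℕ) :
    correlation K v c h κ M =
      ((Nat.count (fun n => K ≤ κ (2 * n + c) + v ∧ K ≤ κ (2 * (n + h) + c) + v) M +
        Nat.count (fun n => κ (2 * n + c) < v ∧ κ (2 * (n + h) + c) < v) M : ℕ) : ℤ) -
      ((Nat.count (fun n => K ≤ κ (2 * n + c) + v ∧ κ (2 * (n + h) + c) < v) M +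
        Nat.count (fun n => κ (2 * n + c) < v ∧ K ≤ κ (2 * (n + h) + c) + v) M : ℕ) : ℤ) := by
  unfold correlation
  induction M with
  | zero => simp
  | succ M ih =>
    rw [Finset.sum_range_succ, ih]
    simp only [Nat.count_succ, tailSign]
    split_ifs <;> omega

theorem natCast_le_abs_sub_iff (r a b : ℕ) : (r : ℤ) ≤ |(a : ℤ) - b| ↔ b + r ≤ a ∨ a + r ≤ b := by
  rw [le_abs]; omega

theorem primrecPred_isBad :
    PrimrecPred fun z : ℕ × List ℕ => IsBad z.1 fun n => z.2.getD n 0 := by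
  have hpow : Primrec fun z : ℕ × List ℕ => z.1 ^ 16 :=
    primrec_natPow.comp Primrec.fst (Primrec.const 16)
  have hK : Primrec fun z : ℕ × List ℕ => 2 ^ (4 * z.1) :=
    primrec_natPow.comp (Primrec.const 2) (Primrec.nat_mul.comp (Primrec.const 4) Primrec.fst)
  have hget : ∀ {γ : Type} [Primcodable γ] {f : γ → List ℕ} {i : γ → ℕ}, Primrec f → Primrec i →
      Primrec fun a => (f a).getD (i a) 0 := fun hf hi => (Primrec.list_getD 0).comp hf hi
  refine PrimrecPred.or ?_ ?_
  · refine PrimrecPred.existsLt (Primrec.nat_mul.comp (Primrec.const 4) hpow) (PrimrecPred.or ?_ ?_)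
    · exact Primrec.nat_lt.comp (hget (Primrec.snd.comp Primrec.fst) Primrec.snd)
        (primrec_natPow.comp (Primrec.const 2) (Primrec.fst.comp Primrec.fst))
    · exact Primrec.nat_le.comp (hK.comp Primrec.fst) (Primrec.nat_add.comp
        (hget (Primrec.snd.comp Primrec.fst) Primrec.snd)
        (primrec_natPow.comp (Primrec.const 2) (Primrec.fst.comp Primrec.fst)))
  · refine PrimrecPred.existsLt (Primrec.const 2) ?_
    refine PrimrecPred.existsLt (Primrec.succ.comp (hpow.comp Primrec.fst)) ?_
    refine PrimrecPred.existsLt (Primrec.succ.comp (hpow.comp (Primrec.fst.comp Primrec.fst))) ?_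
    refine PrimrecPred.existsLt (hK.comp (Primrec.fst.comp (Primrec.fst.comp Primrec.fst))) ?_
    have f1 : Primrec fun z : ((((ℕ × List ℕ) × ℕ) × ℕ) × ℕ) × ℕ => z.1.1.1.1 :=
      Primrec.fst.comp (Primrec.fst.comp (Primrec.fst.comp Primrec.fst))
    have fc : Primrec fun z : ((((ℕ × List ℕ) × ℕ) × ℕ) × ℕ) × ℕ => z.1.1.1.2 :=
      Primrec.snd.comp (Primrec.fst.comp (Primrec.fst.comp Primrec.fst))
    have fh : Primrec fun z : ((((ℕ × List ℕ) × ℕ) × ℕ) × ℕ) × ℕ => z.1.1.2 :=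
      Primrec.snd.comp (Primrec.fst.comp Primrec.fst)
    have fM : Primrec fun z : ((((ℕ × List ℕ) × ℕ) × ℕ) × ℕ) × ℕ => z.1.2 :=
      Primrec.snd.comp Primrec.fst
    have fv : Primrec fun z : ((((ℕ × List ℕ) × ℕ) × ℕ) × ℕ) × ℕ => z.2 := Primrec.snd
    have fK := hK.comp f1
    have two : ∀ {γ : Type} [Primcodable γ], Primrec fun _ : γ => 2 := Primrec.const 2
    have ix : Primrec fun w : (((((ℕ × List ℕ) × ℕ) × ℕ) × ℕ) × ℕ) × ℕ =>
        w.1.1.1.1.1.2.getD (2 * w.2 + w.1.1.1.1.2) 0 :=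
      hget (Primrec.snd.comp (f1.comp Primrec.fst))
        (Primrec.nat_add.comp (Primrec.nat_mul.comp two Primrec.snd) (fc.comp Primrec.fst))
    have iy : Primrec fun w : (((((ℕ × List ℕ) × ℕ) × ℕ) × ℕ) × ℕ) × ℕ =>
        w.1.1.1.1.1.2.getD (2 * (w.2 + w.1.1.1.2) + w.1.1.1.1.2) 0 :=
      hget (Primrec.snd.comp (f1.comp Primrec.fst))
        (Primrec.nat_add.comp (Primrec.nat_mul.comp two
          (Primrec.nat_add.comp Primrec.snd (fh.comp Primrec.fst))) (fc.comp Primrec.fst))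
    have wv := fv.comp (Primrec.fst (α := ((((ℕ × List ℕ) × ℕ) × ℕ) × ℕ) × ℕ) (β := ℕ))
    have wK := fK.comp (Primrec.fst (α := ((((ℕ × List ℕ) × ℕ) × ℕ) × ℕ) × ℕ) (β := ℕ))
    have hix := Primrec.nat_le.comp wK (Primrec.nat_add.comp ix wv)
    have hiy := Primrec.nat_le.comp wK (Primrec.nat_add.comp iy wv)
    have lox := Primrec.nat_lt.comp ix wv
    have loy := Primrec.nat_lt.comp iy wv
    have cA := primrec_boundedCount (hix.and hiy) fM
    have cB := primrec_boundedCount (lox.and loy) fM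
    have cC := primrec_boundedCount (hix.and loy) fM
    have cD := primrec_boundedCount (lox.and hiy) fM
    have hr : Primrec fun z : ((((ℕ × List ℕ) × ℕ) × ℕ) × ℕ) × ℕ => z.1.1.1.1.1 ^ 10 :=
      primrec_natPow.comp (Primrec.fst.comp f1) (Primrec.const 10)
    have hpos := Primrec.nat_add.comp cA cB
    have hneg := Primrec.nat_add.comp cC cD
    refine PrimrecPred.and (Primrec.nat_le.comp (Primrec.const 1) fh) (PrimrecPred.of_eq
      ((Primrec.nat_le.comp (Primrec.nat_add.comp hneg hr) hpos).or
        (Primrec.nat_le.comp (Primrec.nat_add.comp hpos hr) hneg)) fun z => ?_)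
    rw [correlation_eq_count, ← Nat.cast_pow, natCast_le_abs_sub_iff]

variable (φ : ℕ × ℕ → ℕ)

/-- The first `4 * m` digits of the `n`-th block of `a`, as a number. -/
def blockNum (m : ℕ) (a : ℕ → Bool) (n : ℕ) : ℕ := blockVal (fun i => a (φ (n, i))) (4 * m)

open Classical in
/-- The test whether the string `σ`, continued by zeros, is bad at level `m`. -/
noncomputable def corrTest (m : ℕ) (σ : List Bool) : Bool :=
  decide (IsBad m fun n => if n < 4 * m ^ 16 then blockNum φ m (fun p => σ.getD p false) n else 0)

variable {φ}

theorem computable_blockVal {γ : Type*} [Primcodable γ] {d : γ → ℕ → Bool}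
    (hd : Computable₂ d) : Computable₂ fun a L => blockVal (d a) L := by
  have h1 : Computable fun z : (γ × ℕ) × (ℕ × ℕ) => d z.1.1 z.2.1 :=
    hd.comp (Computable.fst.comp Computable.fst) (Computable.fst.comp Computable.snd)
  have h2 : Computable fun z : (γ × ℕ) × (ℕ × ℕ) => (d z.1.1 z.2.1).toNat :=
    (Primrec.dom_finite Bool.toNat).to_comp.comp h1
  have hstep : Computable₂ fun (z : γ × ℕ) (y : ℕ × ℕ) => 2 * y.2 + (d z.1 y.1).toNat :=
    Primrec.nat_add.to_comp.comp
      (Primrec.nat_mul.to_comp.comp (Computable.const 2) (Computable.snd.comp Computable.snd)) h2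
  refine (Computable.nat_rec (f := fun z : γ × ℕ => z.2) (g := fun _ => 0)
    Computable.snd (Computable.const 0) hstep).of_eq ?_
  rintro ⟨a, L⟩
  induction L with
  | zero => rfl
  | succ L ih => simp only at ih ⊢; rw [ih]; rfl

theorem computable_blockVal_getD (hφ : Computable φ) :
    Computable fun z : (List Bool × ℕ) × ℕ =>
      blockVal (fun i => z.1.1.getD (φ (z.1.2, i)) false) z.2 := by
  have hpos : Computable fun z : (List Bool × ℕ) × ℕ => φ (z.1.2, z.2) :=
    hφ.comp (Computable.pair (Computable.snd.comp Computable.fst) Computable.snd)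
  exact computable_blockVal (d := fun (z : List Bool × ℕ) i => z.1.getD (φ (z.2, i)) false)
    ((Primrec.list_getD false).to_comp.comp (Computable.fst.comp Computable.fst) hpos)

theorem computable_blockNum (hφ : Computable φ) :
    Computable₂ fun (z : ℕ × List Bool) n => blockNum φ z.1 (fun p => z.2.getD p false) n :=
  Computable.comp
    (f := fun z : (List Bool × ℕ) × ℕ => blockVal (fun i => z.1.1.getD (φ (z.1.2, i)) false) z.2)
    (g := fun z : (ℕ × List Bool) × ℕ => ((z.1.2, z.2), 4 * z.1.1))
    (computable_blockVal_getD hφ)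
    (Computable.pair (Computable.pair (Computable.snd.comp Computable.fst) Computable.snd)
      (Primrec.nat_mul.to_comp.comp (Computable.const 4) (Computable.fst.comp Computable.fst)))

theorem computable_map_range {γ δ : Type*} [Primcodable γ] [Primcodable δ] {f : γ → ℕ → δ}
    (hf : Computable₂ f) {N : γ → ℕ} (hN : Computable N) :
    Computable fun a => (List.range (N a)).map (f a) := by
  have hstep : Computable₂ fun (a : γ) (y : ℕ × List δ) => y.2 ++ [f a y.1] :=
    Computable.list_concat.comp (Computable.snd.comp Computable.snd)
      (hf.comp Computable.fst (Computable.fst.comp Computable.snd))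
  refine (Computable.nat_rec (f := N) (g := fun _ => ([] : List δ)) hN
    (Computable.const []) hstep).of_eq ?_
  intro a
  generalize N a = H
  induction H with
  | zero => rfl
  | succ H ih => simp only at ih ⊢; rw [ih]; simp [List.range_succ]

theorem computable_corrTest (hφ : Computable φ) : Computable₂ (corrTest φ) := by
  classical
  have hlist : Computable fun z : ℕ × List Bool =>
      (List.range (4 * z.1 ^ 16)).map (blockNum φ z.1 fun p => z.2.getD p false) :=
    computable_map_range (computable_blockNum hφ) (Primrec.nat_mul.comp (Primrec.const 4)
      (primrec_natPow.comp Primrec.fst (Primrec.const 16))).to_comp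
  obtain ⟨inst, hbad⟩ := primrecPred_isBad
  refine (hbad.to_comp.comp (Computable.pair Computable.fst hlist)).of_eq ?_
  rintro ⟨m, σ⟩
  simp only [corrTest]
  congr 1
  refine congrArg (IsBad m) (funext fun n => ?_)
  by_cases hn : n < 4 * m ^ 16 <;> simp [List.getD_eq_getElem?_getD, hn]

variable (φ) in
/-- A bound for the positions that the test reads at level `m`. -/
def readBound (m : ℕ) : ℕ :=
  ∑ q ∈ Finset.range ((4 * m ^ 16 + 4 * m + 1) ^ 2), (φ q.unpair + 1)

theorem computable_readBound (hφ : Computable φ) : Computable (readBound φ) := by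
  have hstep : Computable₂ fun (_ : ℕ) (y : ℕ × ℕ) => y.2 + (φ y.1.unpair + 1) :=
    Primrec.nat_add.to_comp.comp (Computable.snd.comp Computable.snd)
      (Computable.succ.comp (hφ.comp (Primrec.unpair.to_comp.comp
        (Computable.fst.comp Computable.snd))))
  have hbd : Primrec fun m : ℕ => (4 * m ^ 16 + 4 * m + 1) ^ 2 :=
    primrec_natPow.comp (Primrec.succ.comp (Primrec.nat_add.comp
      (Primrec.nat_mul.comp (Primrec.const 4) (primrec_natPow.comp Primrec.id (Primrec.const 16)))
      (Primrec.nat_mul.comp (Primrec.const 4) Primrec.id))) (Primrec.const 2)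
  refine (Computable.nat_rec (g := fun _ => 0) hbd.to_comp (Computable.const 0) hstep).of_eq ?_
  intro m
  unfold readBound
  generalize (4 * m ^ 16 + 4 * m + 1) ^ 2 = Q
  induction Q with
  | zero => rfl
  | succ Q ih => simp only at ih ⊢; rw [ih, Finset.sum_range_succ]

theorem lt_readBound {m n i : ℕ} (hn : n < 4 * m ^ 16) (hi : i < 4 * m) :
    φ (n, i) < readBound φ m := by
  have hlt : Nat.pair n i < (4 * m ^ 16 + 4 * m + 1) ^ 2 :=
    (Nat.pair_lt_max_add_one_sq n i).trans_le (Nat.pow_le_pow_left (by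
      have := max_le (a := n) (b := i) (c := 4 * m ^ 16 + 4 * m) (by omega) (by omega)
      omega) 2)
  have := Finset.single_le_sum (f := fun q : ℕ => φ q.unpair + 1) (fun _ _ => Nat.zero_le _)
    (Finset.mem_range.2 hlt)
  simp only [Nat.unpair_pair] at this
  exact this

theorem IsBad.congr {m : ℕ} {κ κ' : ℕ → ℕ} (h : ∀ n < 4 * m ^ 16, κ n = κ' n)
    (hb : IsBad m κ) : IsBad m κ' := by
  rcases hb with ⟨n, hn, hb⟩ | ⟨c, hc, d, hd, M, hM, v, hv, h1, hb⟩
  · exact Or.inl ⟨n, hn, h n hn ▸ hb⟩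
  · refine Or.inr ⟨c, hc, d, hd, M, hM, v, hv, h1, ?_⟩
    have : correlation (2 ^ (4 * m)) v c d κ M = correlation (2 ^ (4 * m)) v c d κ' M := by
      refine Finset.sum_congr rfl fun n hn => ?_
      rw [Finset.mem_range] at hn
      rw [h _ (by omega), h _ (by omega)]
    rwa [← this]

theorem blockVal_congr {a b : ℕ → Bool} {L : ℕ} (h : ∀ i < L, a i = b i) :
    blockVal a L = blockVal b L := by
  induction L with
  | zero => rfl
  | succ L ih => rw [blockVal, blockVal, ih fun i hi => h i (by omega), h L (by omega)]

theorem corrTest_eq_true_iff (m : ℕ) (σ : List Bool) :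
    corrTest φ m σ = true ↔ IsBad m (blockNum φ m fun p => σ.getD p false) := by
  classical
  rw [corrTest, decide_eq_true_iff]
  constructor <;> exact IsBad.congr fun n hn => by simp [hn]

theorem corrTest_initSeg_iff (m : ℕ) (α : ℕ → Bool) :
    corrTest φ m (initSeg α (readBound φ m)) = true ↔ IsBad m (blockNum φ m α) := by
  rw [corrTest_eq_true_iff]
  have : ∀ n < 4 * m ^ 16, blockNum φ m (fun p => (initSeg α (readBound φ m)).getD p false) n =
      blockNum φ m α n := fun n hn => blockVal_congr fun i hi => by
    have := lt_readBound (φ := φ) hn hi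
    simp [initSeg, List.getD_eq_getElem?_getD, this]
  exact ⟨IsBad.congr this, IsBad.congr fun n hn => (this n hn).symm⟩

end CorrelationTest

/-! ## Counting the strings that fail the test -/

section Counting

theorem blockVal_compl_add (b : ℕ → Bool) (L : ℕ) :
    blockVal (fun i => !b i) L + blockVal b L + 1 = 2 ^ L := by
  induction L with
  | zero => rfl
  | succ L ih =>
    simp only [blockVal, pow_succ]
    cases b L <;> simp <;> omega

theorem blockVal_mul_two_pow_le (b : ℕ → Bool) (t j : ℕ) :
    blockVal b t * 2 ^ j ≤ blockVal b (t + j) := by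
  induction j with
  | zero => simp
  | succ j ih =>
    rw [← add_assoc, blockVal, pow_succ]
    nlinarith

theorem eq_false_of_blockVal_eq_zero {b : ℕ → Bool} {t : ℕ} (h : blockVal b t = 0) :
    ∀ i < t, b i = false := by
  induction t with
  | zero => intro i hi; omega
  | succ t ih =>
    simp only [blockVal] at h
    intro i hi
    rcases Nat.lt_succ_iff_lt_or_eq.1 hi with h1 | rfl
    · exact ih (by omega) i h1
    · cases hb : b i with
      | false => rfl
      | true => simp [hb] at h

theorem eq_false_of_blockVal_lt {b : ℕ → Bool} {t j : ℕ} (h : blockVal b (t + j) < 2 ^ j) :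
    ∀ i < t, b i = false := by
  refine eq_false_of_blockVal_eq_zero ?_
  by_contra h0
  have := blockVal_mul_two_pow_le b t j
  have h1 : 1 * 2 ^ j ≤ blockVal b t * 2 ^ j := Nat.mul_le_mul_right _ (Nat.one_le_iff_ne_zero.2 h0)
  omega

theorem tailSign_compl {K k k' : ℕ} (v : ℕ) (h : k' + k + 1 = K) :
    tailSign K v k' = -tailSign K v k := by
  unfold tailSign
  split_ifs <;> omega

theorem tailSign_mem (K v k : ℕ) :
    tailSign K v k = 0 ∨ tailSign K v k = 1 ∨ tailSign K v k = -1 := by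
  unfold tailSign
  split_ifs <;> simp

/-- The number of elements with the property `p`. -/
noncomputable def numWith {Ω : Type*} [Fintype Ω] (p : Ω → Prop) : ℕ :=
  (@Finset.filter Ω p (Classical.decPred p) Finset.univ).card

theorem numWith_eq_card {Ω : Type*} [Fintype Ω] (p : Ω → Prop) [DecidablePred p] :
    numWith p = (Finset.univ.filter p).card := by
  unfold numWith
  congr

theorem numWith_le_add {Ω : Type*} [Fintype Ω] {p q r : Ω → Prop} (h : ∀ ω, p ω → q ω ∨ r ω) :
    (numWith p : ℝ) ≤ numWith q + numWith r := by
  classical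
  simp only [numWith_eq_card]
  have h1 : Finset.univ.filter p ⊆ Finset.univ.filter q ∪ Finset.univ.filter r := by
    intro ω
    simpa using h ω
  exact_mod_cast (Finset.card_le_card h1).trans (Finset.card_union_le _ _)

theorem numWith_exists_lt_le {Ω : Type*} [Fintype Ω] {p : ℕ → Ω → Prop} {n : ℕ} {b : ℝ}
    (h : ∀ i < n, (numWith (p i) : ℝ) ≤ b) :
    (numWith fun ω => ∃ i < n, p i ω : ℝ) ≤ n * b := by
  classical
  have h1 : (Finset.univ.filter fun ω => ∃ i < n, p i ω) ⊆
      (Finset.range n).biUnion fun i => Finset.univ.filter (p i) := by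
    intro ω hω
    simpa using hω
  calc (numWith fun ω => ∃ i < n, p i ω : ℝ)
      ≤ ((∑ i ∈ Finset.range n, (Finset.univ.filter (p i)).card : ℕ) : ℝ) := by
        rw [numWith_eq_card]
        exact_mod_cast (Finset.card_le_card h1).trans Finset.card_biUnion_le
    _ ≤ ∑ i ∈ Finset.range n, b := by
        push_cast
        refine Finset.sum_le_sum fun i hi => ?_
        rw [← numWith_eq_card]
        exact h i (Finset.mem_range.1 hi)
    _ = n * b := by simp

section Moment

variable {Ω : Type*} [Fintype Ω] {κ : Ω → ℕ → ℕ} {H K : ℕ}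

theorem sum_exp_add_le_of_odd (e : Equiv.Perm Ω) {C x : Ω → ℝ} (hC : ∀ ω, C (e ω) = C ω)
    (hx : ∀ ω, x (e ω) = -x ω) (hx1 : ∀ ω, x ω ^ 2 ≤ 1) (l : ℝ) :
    ∑ ω, Real.exp (l * (C ω + x ω)) ≤ Real.exp (l ^ 2 / 2) * ∑ ω, Real.exp (l * C ω) := by
  have h1 : ∑ ω, Real.exp (l * (C ω + x ω)) = ∑ ω, Real.exp (l * (C ω - x ω)) := by
    rw [← Equiv.sum_comp e]
    simp [hC, hx, sub_eq_add_neg]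
  have h2 : ∑ ω, Real.exp (l * (C ω + x ω)) =
      ∑ ω, Real.exp (l * C ω) * Real.cosh (l * x ω) := by
    have : ∑ ω, Real.exp (l * (C ω + x ω)) = (∑ ω, Real.exp (l * (C ω + x ω)) +
        ∑ ω, Real.exp (l * (C ω - x ω))) / 2 := by rw [← h1]; ring
    rw [this, ← Finset.sum_add_distrib, Finset.sum_div]
    refine Finset.sum_congr rfl fun ω _ => ?_
    rw [Real.cosh_eq, mul_add, mul_sub, Real.exp_add, sub_eq_add_neg, Real.exp_add]
    ring
  rw [h2, Finset.mul_sum]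
  refine Finset.sum_le_sum fun ω _ => ?_
  rw [mul_comm]
  refine mul_le_mul_of_nonneg_right ((Real.cosh_le_exp_half_sq _).trans ?_) (Real.exp_pos _).le
  refine Real.exp_le_exp.2 ?_
  have : (l * x ω) ^ 2 ≤ l ^ 2 := by
    rw [mul_pow]
    exact mul_le_of_le_one_right (sq_nonneg l) (hx1 ω)
  linarith

/-- For every `n < H` there is a measure preserving map which replaces `κ n` by its complement and
does not change the other numbers. -/
def HasFlips (κ : Ω → ℕ → ℕ) (H K : ℕ) : Prop :=
  ∀ n < H, ∃ e : Equiv.Perm Ω, (∀ ω, ∀ n' ≠ n, κ (e ω) n' = κ ω n') ∧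
    ∀ ω, κ (e ω) n + κ ω n + 1 = K

theorem sum_exp_correlation_le (hκ : HasFlips κ H K) (v c : ℕ) {h : ℕ} (hh : 1 ≤ h) (l : ℝ)
    (M : ℕ) (hM : 2 * (M + h) + c ≤ H + 1) :
    ∑ ω, Real.exp (l * (correlation K v c h (κ ω) M : ℝ)) ≤
      Fintype.card Ω * Real.exp (M * (l ^ 2 / 2)) := by
  induction M with
  | zero => simp [correlation]
  | succ M ih =>
    obtain ⟨e, he1, he2⟩ := hκ (2 * (M + h) + c) (by omega)
    have hC : ∀ ω, (correlation K v c h (κ (e ω)) M : ℝ) = correlation K v c h (κ ω) M := by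
      intro ω
      refine congrArg _ (Finset.sum_congr rfl fun n hn => ?_)
      rw [Finset.mem_range] at hn
      rw [he1 ω _ (by omega), he1 ω _ (by omega)]
    have key := sum_exp_add_le_of_odd e (C := fun ω => (correlation K v c h (κ ω) M : ℝ))
      (x := fun ω => ((tailSign K v (κ ω (2 * M + c)) *
        tailSign K v (κ ω (2 * (M + h) + c)) : ℤ) : ℝ)) hC ?_ ?_ l
    · have hs : ∀ ω, (correlation K v c h (κ ω) (M + 1) : ℝ) = correlation K v c h (κ ω) M +
          ((tailSign K v (κ ω (2 * M + c)) * tailSign K v (κ ω (2 * (M + h) + c)) : ℤ) : ℝ) := by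
        intro ω
        rw [correlation, Finset.sum_range_succ, ← correlation]
        push_cast
        rfl
      simp only [hs]
      refine key.trans ((mul_le_mul_of_nonneg_left (ih (by omega)) (Real.exp_pos _).le).trans
        (le_of_eq ?_))
      push_cast
      rw [add_mul, Real.exp_add, one_mul]
      ring
    · intro ω
      rw [he1 ω (2 * M + c) (by omega), tailSign_compl v (he2 ω)]
      push_cast
      ring
    · intro ω
      rcases tailSign_mem K v (κ ω (2 * M + c)) with h1 | h1 | h1 <;>
      rcases tailSign_mem K v (κ ω (2 * (M + h) + c)) with h2 | h2 | h2 <;> simp [h1, h2]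

theorem numWith_le_of_sum_exp_le {f : Ω → ℝ} {b : ℝ} (hf : ∑ ω, Real.exp (f ω) ≤ b) (r : ℝ) :
    (numWith fun ω => r ≤ f ω : ℝ) ≤ Real.exp (-r) * b := by
  classical
  have h1 : (numWith fun ω => r ≤ f ω : ℝ) * Real.exp r ≤ b := by
    rw [numWith_eq_card]
    calc ((Finset.univ.filter fun ω => r ≤ f ω).card : ℝ) * Real.exp r
        = ∑ ω ∈ Finset.univ.filter (fun ω => r ≤ f ω), Real.exp r := by simp
      _ ≤ ∑ ω ∈ Finset.univ.filter (fun ω => r ≤ f ω), Real.exp (f ω) :=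
          Finset.sum_le_sum fun ω hω => Real.exp_le_exp.2 (Finset.mem_filter.1 hω).2
      _ ≤ ∑ ω, Real.exp (f ω) :=
          Finset.sum_le_sum_of_subset_of_nonneg (Finset.filter_subset _ _)
            fun _ _ _ => (Real.exp_pos _).le
      _ ≤ b := hf
  calc _ = Real.exp (-r) * ((numWith fun ω => r ≤ f ω : ℝ) * Real.exp r) := by
        rw [mul_comm, mul_assoc, ← Real.exp_add]; simp
    _ ≤ _ := mul_le_mul_of_nonneg_left h1 (Real.exp_pos _).le

theorem numWith_correlation_le (hκ : HasFlips κ H K) (v c : ℕ) {h : ℕ} (hh : 1 ≤ h) {l : ℝ}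
    (hl : 0 ≤ l) (M r : ℕ) (hM : 2 * (M + h) + c ≤ H + 1) :
    (numWith fun ω => (r : ℤ) ≤ |correlation K v c h (κ ω) M| : ℝ) ≤
      2 * (Real.exp (-(l * r)) * (Fintype.card Ω * Real.exp (M * (l ^ 2 / 2)))) := by
  have h1 := numWith_le_of_sum_exp_le (sum_exp_correlation_le hκ v c hh l M hM) (l * r)
  have h2 := numWith_le_of_sum_exp_le (sum_exp_correlation_le hκ v c hh (-l) M hM) (l * r)
  rw [neg_sq] at h2
  have h3 := numWith_le_add (p := fun ω => (r : ℤ) ≤ |correlation K v c h (κ ω) M|)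
    (q := fun ω => l * r ≤ l * (correlation K v c h (κ ω) M : ℝ))
    (r := fun ω => l * r ≤ -l * (correlation K v c h (κ ω) M : ℝ)) fun ω hω => by
      rcases le_abs.1 hω with h3 | h3
      · exact Or.inl (mul_le_mul_of_nonneg_left (by exact_mod_cast h3) hl)
      · refine Or.inr ?_
        rw [neg_mul, ← mul_neg]
        exact mul_le_mul_of_nonneg_left (by exact_mod_cast h3) hl
  linarith

end Moment

section Strings

variable {ℓ : ℕ}

/-- The digits of `σ`, followed by zeros. -/
def padded (σ : Fin ℓ → Bool) (p : ℕ) : Bool := (List.ofFn σ).getD p false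

theorem padded_of_lt (σ : Fin ℓ → Bool) {p : ℕ} (hp : p < ℓ) : padded σ p = σ ⟨p, hp⟩ := by
  simp [padded, List.getD_eq_getElem?_getD, hp]

open Classical in
/-- The permutation of the strings which flips the digits at the positions in `S`. -/
noncomputable def flipOn (S : Set ℕ) : Equiv.Perm (Fin ℓ → Bool) :=
  Function.Involutive.toPerm (fun σ i => if (i : ℕ) ∈ S then !σ i else σ i) fun σ => by
    funext i
    by_cases h : (i : ℕ) ∈ S <;> simp [h]

open Classical in
theorem flipOn_apply (S : Set ℕ) (σ : Fin ℓ → Bool) (i : Fin ℓ) :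
    flipOn S σ i = if (i : ℕ) ∈ S then !σ i else σ i := rfl

theorem padded_flipOn_of_mem {S : Set ℕ} (σ : Fin ℓ → Bool) {p : ℕ} (hp : p < ℓ) (hS : p ∈ S) :
    padded (flipOn S σ) p = !padded σ p := by
  rw [padded_of_lt _ hp, padded_of_lt _ hp]
  simp [flipOn_apply, hS]

theorem padded_flipOn_of_notMem {S : Set ℕ} (σ : Fin ℓ → Bool) {p : ℕ} (hS : p ∉ S) :
    padded (flipOn S σ) p = padded σ p := by
  by_cases hp : p < ℓ
  · rw [padded_of_lt _ hp, padded_of_lt _ hp]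
    simp [flipOn_apply, hS]
  · simp [padded, List.getD_eq_getElem?_getD, hp]

open Classical in
theorem card_padded_eq_le {ψ : ℕ → ℕ} (hψ : Function.Injective ψ) (b : Bool) (t : ℕ)
    (ht : ∀ i < t, ψ i < ℓ) :
    (Finset.univ.filter fun σ : Fin ℓ → Bool => ∀ i < t, padded σ (ψ i) = b).card * 2 ^ t
      ≤ 2 ^ ℓ := by
  induction t with
  | zero => simp
  | succ t ih =>
    refine le_trans ?_ (ih fun i hi => ht i (by omega))
    rw [pow_succ, mul_comm (2 ^ t), ← mul_assoc]
    refine Nat.mul_le_mul_right _ ?_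
    set A := Finset.univ.filter fun σ : Fin ℓ → Bool => ∀ i < t + 1, padded σ (ψ i) = b
    have hdisj : Disjoint A (A.image (flipOn {ψ t})) := by
      rw [Finset.disjoint_left]
      intro σ hσ hσ'
      obtain ⟨τ, hτ, rfl⟩ := Finset.mem_image.1 hσ'
      have h1 := (Finset.mem_filter.1 hσ).2 t (by omega)
      have h2 := (Finset.mem_filter.1 hτ).2 t (by omega)
      rw [padded_flipOn_of_mem τ (ht t (by omega)) (Set.mem_singleton _), h2] at h1
      cases b <;> simp at h1
    have hcard : (A.image (flipOn {ψ t})).card = A.card :=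
      Finset.card_image_of_injective _ (Equiv.injective _)
    calc A.card * 2 = (A ∪ A.image (flipOn {ψ t})).card := by
          rw [Finset.card_union_of_disjoint hdisj, hcard, mul_two]
      _ ≤ _ := by
          refine Finset.card_le_card fun σ hσ => ?_
          refine Finset.mem_filter.2 ⟨Finset.mem_univ _, fun i hi => ?_⟩
          rcases Finset.mem_union.1 hσ with h | h
          · exact (Finset.mem_filter.1 h).2 i (by omega)
          · obtain ⟨τ, hτ, rfl⟩ := Finset.mem_image.1 h
            rw [padded_flipOn_of_notMem τ fun h => ?_]
            · exact (Finset.mem_filter.1 hτ).2 i (by omega)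
            · have := hψ h
              omega

variable {φ : ℕ × ℕ → ℕ}

theorem hasFlips_blockNum (hφ : Function.Injective φ) (m : ℕ) :
    HasFlips (fun σ : Fin (readBound φ m) → Bool => blockNum φ m (padded σ)) (4 * m ^ 16)
      (2 ^ (4 * m)) := by
  intro n hn
  refine ⟨flipOn {p | ∃ i, p = φ (n, i)}, fun σ n' hn' => ?_, fun σ => ?_⟩
  · refine blockVal_congr fun i _ => padded_flipOn_of_notMem σ ?_
    rintro ⟨j, hj⟩
    exact hn' (congrArg Prod.fst (hφ hj))
  · have : blockNum φ m (padded (flipOn {p | ∃ i, p = φ (n, i)} σ)) n =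
        blockVal (fun i => !padded σ (φ (n, i))) (4 * m) :=
      blockVal_congr fun i hi => padded_flipOn_of_mem σ (lt_readBound hn hi) ⟨i, rfl⟩
    simp only [this]
    exact blockVal_compl_add _ _

theorem numWith_edge_le (hφ : Function.Injective φ) {m n : ℕ} (hn : n < 4 * m ^ 16) :
    (numWith fun σ : Fin (readBound φ m) → Bool => blockNum φ m (padded σ) n < 2 ^ m ∨
        2 ^ (4 * m) ≤ blockNum φ m (padded σ) n + 2 ^ m : ℝ) ≤
      2 * (2 ^ readBound φ m / 2 ^ (3 * m)) := by
  classical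
  have hinj : Function.Injective fun i => φ (n, i) := fun i j h => congrArg Prod.snd (hφ h)
  have hle : ∀ b, (numWith fun σ : Fin (readBound φ m) → Bool =>
      ∀ i < 3 * m, padded σ (φ (n, i)) = b : ℝ) ≤ 2 ^ readBound φ m / 2 ^ (3 * m) := by
    intro b
    rw [le_div_iff₀ (by positivity), numWith_eq_card]
    exact_mod_cast card_padded_eq_le (ℓ := readBound φ m) hinj b (3 * m)
      fun i hi => lt_readBound hn (by omega)
  have h3 := numWith_le_add (p := fun σ : Fin (readBound φ m) → Bool =>
      blockNum φ m (padded σ) n < 2 ^ m ∨ 2 ^ (4 * m) ≤ blockNum φ m (padded σ) n + 2 ^ m)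
    (q := fun σ => ∀ i < 3 * m, padded σ (φ (n, i)) = false)
    (r := fun σ => ∀ i < 3 * m, padded σ (φ (n, i)) = true) fun σ hσ => by
      have h4 : 4 * m = 3 * m + m := by ring
      rcases hσ with h1 | h1
      · rw [blockNum, h4] at h1
        exact Or.inl (eq_false_of_blockVal_lt h1)
      · have h2 := blockVal_compl_add (fun i => padded σ (φ (n, i))) (4 * m)
        rw [blockNum] at h1
        have h3 : blockVal (fun i => !padded σ (φ (n, i))) (3 * m + m) < 2 ^ m := by
          rw [← h4]; omega
        refine Or.inr fun i hi => ?_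
        simpa using eq_false_of_blockVal_lt h3 i hi
  linarith [hle true, hle false]

theorem numWith_level_correlation_le (hφ : Function.Injective φ) {m : ℕ} (hm : 1 ≤ m) {c : ℕ}
    (hc : c < 2) {h : ℕ} (hh : h < m ^ 16 + 1) {M : ℕ} (hM : M < m ^ 16 + 1) (v : ℕ) :
    (numWith fun σ : Fin (readBound φ m) → Bool => 1 ≤ h ∧ (m : ℤ) ^ 10 ≤
        |correlation (2 ^ (4 * m)) v c h (blockNum φ m (padded σ)) M| : ℝ) ≤
      2 * (2 ^ readBound φ m * Real.exp (-(m ^ 4 / 2))) := by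
  have hm0 : (0 : ℝ) < m := by exact_mod_cast hm
  by_cases h1 : 1 ≤ h
  swap
  · classical
    rw [numWith_eq_card]
    simp only [h1, false_and, Finset.filter_false, Finset.card_empty, Nat.cast_zero]
    positivity
  have hM' : (M : ℝ) ≤ (m : ℝ) ^ 16 := by exact_mod_cast Nat.lt_succ_iff.1 hM
  have hcard : (Fintype.card (Fin (readBound φ m) → Bool) : ℝ) = 2 ^ readBound φ m := by simp
  have key := numWith_correlation_le (hasFlips_blockNum hφ m) v c h1 (l := ((m : ℝ) ^ 6)⁻¹)
    (by positivity) M (m ^ 10) (by omega)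
  simp only [h1, true_and]
  rw [Nat.cast_pow] at key
  refine key.trans ?_
  rw [mul_left_comm (Real.exp _), ← Real.exp_add, hcard]
  refine mul_le_mul_of_nonneg_left (mul_le_mul_of_nonneg_left (Real.exp_le_exp.2 ?_)
    (by positivity)) (by norm_num)
  have e1 : ((m : ℝ) ^ 6)⁻¹ * ((m ^ 10 : ℕ) : ℝ) = (m : ℝ) ^ 4 := by
    push_cast
    field_simp
  have e2 : (m : ℝ) ^ 16 * ((((m : ℝ) ^ 6)⁻¹) ^ 2 / 2) = (m : ℝ) ^ 4 / 2 := by field_simp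
  have e3 : (M : ℝ) * ((((m : ℝ) ^ 6)⁻¹) ^ 2 / 2) ≤ (m : ℝ) ^ 4 / 2 :=
    e2 ▸ mul_le_mul_of_nonneg_right hM' (by positivity)
  rw [e1]
  linarith

theorem numWith_isBad_le (hφ : Function.Injective φ) {m : ℕ} (hm : 1 ≤ m) :
    (numWith fun σ : Fin (readBound φ m) → Bool => IsBad m (blockNum φ m (padded σ)) : ℝ) ≤
      2 ^ readBound φ m * (8 * m ^ 16 / 2 ^ (3 * m) +
        4 * (m ^ 16 + 1) ^ 2 * 2 ^ (4 * m) * Real.exp (-(m ^ 4 / 2))) := by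
  have hedge := numWith_exists_lt_le (n := 4 * m ^ 16)
    fun n hn => numWith_edge_le hφ (m := m) (n := n) hn
  have hcorr := numWith_exists_lt_le (n := 2) fun c hc =>
    numWith_exists_lt_le (n := m ^ 16 + 1) fun h hh =>
      numWith_exists_lt_le (n := m ^ 16 + 1) fun M hM =>
        numWith_exists_lt_le (n := 2 ^ (4 * m)) fun v _ =>
          numWith_level_correlation_le hφ hm hc hh hM v
  have h3 := numWith_le_add (p := fun σ : Fin (readBound φ m) → Bool =>
    IsBad m (blockNum φ m (padded σ))) fun σ hσ => hσ
  push_cast at hedge hcorr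
  refine (h3.trans (add_le_add hedge hcorr)).trans (le_of_eq ?_)
  ring

theorem eventually_isBad_bound_le :
    ∀ᶠ m : ℕ in Filter.atTop, (2 : ℝ) ^ (2 * m) * (8 * m ^ 16 / 2 ^ (3 * m) +
        4 * (m ^ 16 + 1) ^ 2 * 2 ^ (4 * m) * Real.exp (-(m ^ 4 / 2))) ≤ 1 := by
  have key : ∀ k : ℕ, Filter.Tendsto (fun m : ℕ => (m : ℝ) ^ k * (1 / 2) ^ m) Filter.atTop
      (nhds 0) := fun k => tendsto_pow_const_mul_const_pow_of_abs_lt_one k (by norm_num [abs_of_pos])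
  have h1 := (key 16).const_mul 8
  have h2 := (key 32).const_mul 16
  rw [mul_zero] at h1 h2
  filter_upwards [h1.eventually (gt_mem_nhds (show (0 : ℝ) < 1 / 2 by norm_num)),
    h2.eventually (gt_mem_nhds (show (0 : ℝ) < 1 / 2 by norm_num)),
    Filter.eventually_ge_atTop 3] with m hm1 hm2 hm3
  have hm3' : (3 : ℝ) ≤ m := by exact_mod_cast hm3
  have e1 : (2 : ℝ) ^ (2 * m) * (8 * m ^ 16 / 2 ^ (3 * m)) = 8 * ((m : ℝ) ^ 16 * (1 / 2) ^ m) := by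
    have : (2 : ℝ) ^ (3 * m) = 2 ^ (2 * m) * 2 ^ m := by rw [← pow_add]; congr 1; ring
    rw [this, one_div, inv_pow]
    field_simp
  have e2 : Real.exp (-((m : ℝ) ^ 4 / 2)) ≤ (1 / 2) ^ (7 * m) := by
    have h27 : (27 : ℝ) ≤ (m : ℝ) ^ 3 := by
      calc (27 : ℝ) = 3 ^ 3 := by norm_num
        _ ≤ _ := pow_le_pow_left₀ (by norm_num) hm3' 3
    have hlog : Real.log 2 ≤ 1 := by linarith [Real.log_two_lt_d9]
    have : ((1 : ℝ) / 2) ^ (7 * m) = Real.exp (-(Real.log 2 * (7 * m))) := by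
      rw [one_div, inv_pow, Real.exp_neg, Real.exp_mul, Real.exp_log (by norm_num)]
      norm_cast
    rw [this]
    refine Real.exp_le_exp.2 (neg_le_neg ?_)
    have e4 : (m : ℝ) ^ 4 = m ^ 3 * m := by ring
    rw [e4]
    nlinarith
  have e3 : (4 : ℝ) * (m ^ 16 + 1) ^ 2 ≤ 16 * m ^ 32 := by
    have : (1 : ℝ) ≤ (m : ℝ) ^ 16 := one_le_pow₀ (by linarith)
    have h4 : ((m : ℝ) ^ 16 + 1) ^ 2 ≤ (2 * m ^ 16) ^ 2 :=
      pow_le_pow_left₀ (by positivity) (by linarith) 2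
    calc (4 : ℝ) * (m ^ 16 + 1) ^ 2 ≤ 4 * (2 * m ^ 16) ^ 2 := by linarith
      _ = _ := by ring
  have e5 : (2 : ℝ) ^ (2 * m) * (4 * (m ^ 16 + 1) ^ 2 * 2 ^ (4 * m) * Real.exp (-(m ^ 4 / 2))) ≤
      16 * ((m : ℝ) ^ 32 * (1 / 2) ^ m) := by
    calc (2 : ℝ) ^ (2 * m) * (4 * (m ^ 16 + 1) ^ 2 * 2 ^ (4 * m) * Real.exp (-(m ^ 4 / 2)))
        ≤ 2 ^ (2 * m) * (16 * m ^ 32 * 2 ^ (4 * m) * (1 / 2) ^ (7 * m)) := by gcongr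
      _ = 16 * ((m : ℝ) ^ 32 * (1 / 2) ^ m) := by
        have : ((1 : ℝ) / 2) ^ (7 * m) = (1 / 2) ^ (2 * m) * (1 / 2) ^ (4 * m) * (1 / 2) ^ m := by
          rw [← pow_add, ← pow_add]; congr 1; ring
        have h5 : ∀ j : ℕ, (2 : ℝ) ^ j * (1 / 2) ^ j = 1 := fun j => by
          rw [← mul_pow]; norm_num
        rw [this]
        calc _ = 16 * ((m : ℝ) ^ 32 * (1 / 2) ^ m) * (2 ^ (2 * m) * (1 / 2) ^ (2 * m)) *
              (2 ^ (4 * m) * (1 / 2) ^ (4 * m)) := by ring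
          _ = _ := by rw [h5, h5]; ring
  rw [mul_add, e1]
  linarith

end Strings

end Counting

/-- The blocks of a sequence in `KC` are bad at finitely many levels only. -/
theorem eventually_not_isBad {U : List Bool →. List Bool} (hU : IsOptimalMachine U)
    {φ : ℕ × ℕ → ℕ} (hφ : Computable φ) (hinj : Function.Injective φ)
    {α : ℕ → Bool} (hα : α ∈ KC U) :
    ∀ᶠ m in Filter.atTop, ¬ IsBad m (blockNum φ m α) := by
  classical
  have h := eventually_not_mem_of_mem_KC hU hα (computable_corrTest hφ) (computable_readBound hφ) ?_
  · filter_upwards [h] with m hm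
    rw [← corrTest_initSeg_iff, hm]
    simp
  · filter_upwards [eventually_isBad_bound_le, Filter.eventually_ge_atTop 1] with m hm hm1
    have h1 := numWith_isBad_le hinj hm1
    have h2 : (Finset.univ.filter fun σ : Fin (readBound φ m) → Bool =>
        corrTest φ m (List.ofFn σ) = true) =
        Finset.univ.filter fun σ : Fin (readBound φ m) → Bool =>
          IsBad m (blockNum φ m (padded σ)) :=
      Finset.filter_congr fun σ _ => corrTest_eq_true_iff m _
    rw [h2, ← numWith_eq_card]
    have h3 := mul_le_mul_of_nonneg_left h1 (show (0 : ℝ) ≤ 2 ^ (2 * m) by positivity)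
    rw [mul_left_comm] at h3
    have h4 := h3.trans (mul_le_of_le_one_right (by positivity) hm)
    exact_mod_cast h4

/-! ## Trigonometric sums and correlations -/

section TrigSums

theorem sq_add_sq_trigSum_eq (a : ℕ → ℝ) (θ : ℝ) (M : ℕ) :
    (∑ n ∈ Finset.range M, a n * Real.cos (n * θ)) ^ 2 +
      (∑ n ∈ Finset.range M, a n * Real.sin (n * θ)) ^ 2 =
    ∑ n ∈ Finset.range M, a n ^ 2 + 2 * ∑ j ∈ Finset.range M, Real.cos ((j + 1) * θ) *
      ∑ n ∈ Finset.range (M - (j + 1)), a n * a (n + (j + 1)) := by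
  induction M with
  | zero => simp
  | succ M ih =>
    have h1 : ∑ j ∈ Finset.range (M + 1), Real.cos ((j + 1) * θ) *
        ∑ n ∈ Finset.range (M + 1 - (j + 1)), a n * a (n + (j + 1)) =
        ∑ j ∈ Finset.range M, Real.cos ((j + 1) * θ) *
          ∑ n ∈ Finset.range (M - (j + 1)), a n * a (n + (j + 1)) +
        a M * ∑ j ∈ Finset.range M, Real.cos ((j + 1) * θ) * a (M - 1 - j) := by
      rw [Finset.sum_range_succ, Nat.sub_self, Finset.range_zero, Finset.sum_empty, mul_zero,
        add_zero, Finset.mul_sum, ← Finset.sum_add_distrib]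
      refine Finset.sum_congr rfl fun j hj => ?_
      rw [Finset.mem_range] at hj
      have e1 : M + 1 - (j + 1) = (M - (j + 1)) + 1 := by omega
      have e2 : M - (j + 1) = M - 1 - j := by omega
      have e3 : M - 1 - j + (j + 1) = M := by omega
      rw [e1, Finset.sum_range_succ, e2, e3]
      ring
    have h2 : ∑ j ∈ Finset.range M, Real.cos ((j + 1) * θ) * a (M - 1 - j) =
        Real.cos (M * θ) * ∑ n ∈ Finset.range M, a n * Real.cos (n * θ) +
        Real.sin (M * θ) * ∑ n ∈ Finset.range M, a n * Real.sin (n * θ) := by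
      rw [← Finset.sum_range_reflect (fun j : ℕ => Real.cos ((j + 1) * θ) * a (M - 1 - j)),
        Finset.mul_sum, Finset.mul_sum, ← Finset.sum_add_distrib]
      refine Finset.sum_congr rfl fun n hn => ?_
      rw [Finset.mem_range] at hn
      have e1 : M - 1 - (M - 1 - n) = n := by omega
      have e2 : (((M - 1 - n : ℕ) : ℝ) + 1) * θ = M * θ - n * θ := by
        have : ((M - 1 - n : ℕ) : ℝ) + 1 = M - n := by
          rw [eq_sub_iff_add_eq]
          exact_mod_cast (by omega : M - 1 - n + 1 + n = M)
        rw [this]; ring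
      rw [e1, e2, Real.cos_sub]
      ring
    rw [Finset.sum_range_succ, Finset.sum_range_succ, Finset.sum_range_succ, h1, h2]
    have h3 := Real.cos_sq_add_sin_sq (M * θ)
    linear_combination ih + a M ^ 2 * h3

theorem sq_add_sq_trigSum_le {a : ℕ → ℝ} (ha : ∀ n, a n ^ 2 ≤ 1) {N : ℕ} {r : ℝ}
    (hr : ∀ h, 1 ≤ h → h ≤ N → ∀ M ≤ N, |∑ n ∈ Finset.range M, a n * a (n + h)| ≤ r)
    (θ : ℝ) {M : ℕ} (hM : M ≤ N) :
    (∑ n ∈ Finset.range M, a n * Real.cos (n * θ)) ^ 2 +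
      (∑ n ∈ Finset.range M, a n * Real.sin (n * θ)) ^ 2 ≤ M * (1 + 2 * r) := by
  rw [sq_add_sq_trigSum_eq]
  have h1 : ∑ n ∈ Finset.range M, a n ^ 2 ≤ ∑ n ∈ Finset.range M, (1 : ℝ) :=
    Finset.sum_le_sum fun n _ => ha n
  have h2 : ∑ j ∈ Finset.range M, Real.cos ((j + 1) * θ) *
      ∑ n ∈ Finset.range (M - (j + 1)), a n * a (n + (j + 1)) ≤ ∑ j ∈ Finset.range M, r := by
    refine Finset.sum_le_sum fun j hj => ?_
    rw [Finset.mem_range] at hj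
    refine (le_abs_self _).trans ?_
    rw [abs_mul]
    exact (mul_le_of_le_one_left (abs_nonneg _) (Real.abs_cos_le_one _)).trans
      (hr (j + 1) (by omega) (by omega) _ (by omega))
  simp only [Finset.sum_const, Finset.card_range, nsmul_eq_mul] at h1 h2
  linarith

/-- The trigonometric sums of the tail signs are small at a level which is not bad. -/
theorem abs_sum_tailSign_le {m : ℕ} (hm : 1 ≤ m) {κ : ℕ → ℕ} (hκ : ¬ IsBad m κ) {c : ℕ}
    (hc : c < 2) {v : ℕ} (hv : v < 2 ^ (4 * m)) (θ : ℝ) {M : ℕ} (hM : M ≤ m ^ 16) :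
    |∑ n ∈ Finset.range M, (tailSign (2 ^ (4 * m)) v (κ (2 * n + c)) : ℝ) * Real.cos (n * θ)|
        ≤ 2 * m ^ 13 ∧
    |∑ n ∈ Finset.range M, (tailSign (2 ^ (4 * m)) v (κ (2 * n + c)) : ℝ) * Real.sin (n * θ)|
        ≤ 2 * m ^ 13 := by
  have hm1 : (1 : ℝ) ≤ m := by exact_mod_cast hm
  have key := sq_add_sq_trigSum_le (a := fun n => (tailSign (2 ^ (4 * m)) v (κ (2 * n + c)) : ℝ))
    (N := m ^ 16) (r := (m : ℝ) ^ 10) (fun n => ?_) (fun h h1 hh M hM => ?_) θ hM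
  · have hM' : (M : ℝ) ≤ (m : ℝ) ^ 16 := by exact_mod_cast hM
    have h10 : (1 : ℝ) ≤ (m : ℝ) ^ 10 := one_le_pow₀ hm1
    have hb : (M : ℝ) * (1 + 2 * m ^ 10) ≤ (2 * m ^ 13) ^ 2 := by
      calc (M : ℝ) * (1 + 2 * m ^ 10) ≤ m ^ 16 * (4 * m ^ 10) := by gcongr; linarith
        _ = _ := by ring
    constructor
    · refine abs_le_of_sq_le_sq ?_ (by positivity)
      exact ((le_add_of_nonneg_right (sq_nonneg _)).trans key).trans hb
    · refine abs_le_of_sq_le_sq ?_ (by positivity)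
      exact ((le_add_of_nonneg_left (sq_nonneg _)).trans key).trans hb
  · rcases tailSign_mem (2 ^ (4 * m)) v (κ (2 * n + c)) with h | h | h <;> simp [h]
  · have h2 : ¬ (m : ℤ) ^ 10 ≤ |correlation (2 ^ (4 * m)) v c h κ M| := fun h3 =>
      hκ (Or.inr ⟨c, hc, h, by omega, M, by omega, v, hv, h1, h3⟩)
    have h3 := (not_le.1 h2).le
    have h4 : |((correlation (2 ^ (4 * m)) v c h κ M : ℤ) : ℝ)| ≤ (m : ℝ) ^ 10 := by
      exact_mod_cast h3
    rw [correlation] at h4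
    push_cast at h4
    exact h4

end TrigSums

/-! ## The inverse of the Gaussian distribution function -/

section GaussianInverse

open MeasureTheory ProbabilityTheory

theorem gaussDF_sub_gaussDF (x y : ℝ) :
    gaussDF y - gaussDF x =
      (Real.sqrt (2 * Real.pi))⁻¹ * ∫ t in x..y, Real.exp (-t ^ 2 / 2) := by
  have hi : Integrable fun t : ℝ => Real.exp (-t ^ 2 / 2) := by
    refine (integrable_exp_neg_mul_sq (b := 1 / 2) (by norm_num)).congr
      (Filter.Eventually.of_forall fun t => ?_)
    ring_nf
  rw [← intervalIntegral.integral_Iic_sub_Iic hi.integrableOn hi.integrableOn, gaussDF, gaussDF]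
  ring

theorem le_gaussDF_sub_gaussDF {x y q : ℝ} (hxy : x ≤ y)
    (hq : ∀ t ∈ Set.Icc x y, q ≤ Real.exp (-t ^ 2 / 2)) :
    (Real.sqrt (2 * Real.pi))⁻¹ * (q * (y - x)) ≤ gaussDF y - gaussDF x := by
  rw [gaussDF_sub_gaussDF]
  refine mul_le_mul_of_nonneg_left ?_ (by positivity)
  have hc : Continuous fun t : ℝ => Real.exp (-t ^ 2 / 2) := by fun_prop
  have := intervalIntegral.integral_mono_on hxy (intervalIntegrable_const (c := q) (μ := volume))
    (hc.intervalIntegrable x y) hq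
  rwa [intervalIntegral.integral_const, smul_eq_mul, mul_comm] at this

theorem strictMono_gaussDF : StrictMono gaussDF := by
  intro x y hxy
  have hc : Continuous fun t : ℝ => Real.exp (-t ^ 2 / 2) := by fun_prop
  rw [← sub_pos, gaussDF_sub_gaussDF]
  have : 0 < ∫ t in x..y, Real.exp (-t ^ 2 / 2) :=
    intervalIntegral.intervalIntegral_pos_of_pos_on (hc.intervalIntegrable x y)
      (fun t _ => Real.exp_pos _) hxy
  positivity

theorem gaussDF_neg (x : ℝ) : gaussDF (-x) = 1 - gaussDF x := by
  rw [gaussDF_eq, gaussDF_eq]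
  have h1 : (gaussianReal 0 1).map (fun x : ℝ => -x) = gaussianReal 0 1 := by
    rw [gaussianReal_map_neg, neg_zero]
  have : NullSingletonClass (gaussianReal 0 1) := nullSingletonClass_gaussianReal one_ne_zero
  conv_lhs => rw [← h1]
  rw [map_measureReal_apply measurable_neg measurableSet_Iic]
  have h2 : (fun x : ℝ => -x) ⁻¹' Set.Iic (-x) = (Set.Iio x)ᶜ := by
    ext t; simp
  rw [h2, probReal_compl_eq_one_sub measurableSet_Iio, measureReal_congr Iio_ae_eq_Iic]

theorem gaussDF_le_exp {x : ℝ} (hx : x ≤ 0) : gaussDF x ≤ Real.exp (-x ^ 2 / 2) := by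
  rw [gaussDF_eq]
  have h := measure_le_le_exp_mul_mgf (μ := gaussianReal 0 1) (X := id) (t := x) x hx
    (by simpa using integrable_exp_mul_gaussianReal (μ := 0) (v := 1) x)
  rw [mgf_id_gaussianReal] at h
  refine h.trans (le_of_eq ?_)
  simp only
  rw [← Real.exp_add]
  congr 1
  simp only [NNReal.coe_one]
  ring

theorem le_exp_of_gaussDF_mem {p t : ℝ} (h : gaussDF t ∈ Set.Icc p (1 - p)) :
    p ≤ Real.exp (-t ^ 2 / 2) := by
  rcases le_total t 0 with ht | ht
  · exact h.1.trans (gaussDF_le_exp ht)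
  · have h1 := gaussDF_le_exp (neg_nonpos.2 ht)
    rw [gaussDF_neg, neg_sq] at h1
    linarith [h.2]

theorem g_gaussDF (x : ℝ) : g (gaussDF x) = x :=
  Function.leftInverse_invFun strictMono_gaussDF.injective x

theorem g_one_sub {a : ℝ} (ha : a ∈ Set.Ioo (0 : ℝ) 1) : g (1 - a) = -g a := by
  conv_lhs => rw [← gaussDF_g ha, ← gaussDF_neg, g_gaussDF]

theorem g_half : g (1 / 2) = 0 := by
  have h := g_one_sub (a := 1 / 2) ⟨by norm_num, by norm_num⟩
  norm_num at h ⊢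
  linarith

theorem g_le_g {a b : ℝ} (ha : 0 < a) (hab : a ≤ b) (hb : b < 1) : g a ≤ g b := by
  rw [← strictMono_gaussDF.le_iff_le, gaussDF_g ⟨ha, hab.trans_lt hb⟩,
    gaussDF_g ⟨ha.trans_le hab, hb⟩]
  exact hab

theorem le_exp_g {p a : ℝ} (hp : 0 < p) (ha : a ∈ Set.Icc p (1 - p)) :
    p ≤ Real.exp (-g a ^ 2 / 2) := by
  refine le_exp_of_gaussDF_mem ?_
  rwa [gaussDF_g ⟨by linarith [ha.1], by linarith [ha.2]⟩]

theorem g_sub_g_le {p a b : ℝ} (hp : 0 < p) (ha : p ≤ a) (hab : a ≤ b) (hb : b ≤ 1 - p) :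
    g b - g a ≤ 3 / p * (b - a) := by
  have ha' : a ∈ Set.Ioo (0 : ℝ) 1 := ⟨by linarith, by linarith⟩
  have hb' : b ∈ Set.Ioo (0 : ℝ) 1 := ⟨by linarith, by linarith⟩
  have h := le_gaussDF_sub_gaussDF (q := p) (g_le_g ha'.1 hab hb'.2) fun t ht => by
    refine le_exp_of_gaussDF_mem ⟨ha.trans ?_, le_trans ?_ hb⟩
    · rw [← gaussDF_g ha']
      exact strictMono_gaussDF.monotone ht.1
    · rw [← gaussDF_g hb']
      exact strictMono_gaussDF.monotone ht.2
  rw [gaussDF_g ha', gaussDF_g hb'] at h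
  have hs : Real.sqrt (2 * Real.pi) ≤ 3 := by
    rw [Real.sqrt_le_left (by norm_num)]
    linarith [Real.pi_lt_d2]
  have hs0 : 0 < Real.sqrt (2 * Real.pi) := by positivity
  rw [inv_mul_le_iff₀ hs0] at h
  rw [div_mul_eq_mul_div, le_div_iff₀ hp, mul_comm]
  exact h.trans (mul_le_mul_of_nonneg_right hs (by linarith))

theorem abs_g_two_pow_le {L : ℕ} (hL : 1 ≤ L) : |g (1 / 2 ^ L)| ≤ 2 * L := by
  have h2 : (2 : ℝ) ≤ 2 ^ L := by
    calc (2 : ℝ) = 2 ^ 1 := by norm_num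
      _ ≤ 2 ^ L := pow_le_pow_right₀ (by norm_num) hL
  have h3 : (1 : ℝ) / 2 ^ L ≤ 1 / 2 := one_div_le_one_div_of_le (by norm_num) h2
  have h := le_exp_g (p := 1 / 2 ^ L) (a := 1 / 2 ^ L) (by positivity) ⟨le_rfl, by linarith⟩
  have h4 : (1 : ℝ) / 2 ^ L = Real.exp (-(Real.log 2 * L)) := by
    rw [Real.exp_neg, Real.exp_mul, Real.exp_log (by norm_num), Real.rpow_natCast, one_div]
  conv_lhs at h => rw [h4]
  have h5 := Real.exp_le_exp.1 h
  have hlog : Real.log 2 ≤ 1 := by linarith [Real.log_two_lt_d9]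
  have hL' : (1 : ℝ) ≤ L := by exact_mod_cast hL
  refine abs_le_of_sq_le_sq ?_ (by positivity)
  nlinarith

/-! ### Step functions approximating `g` -/

theorem summable_binaryReal (b : ℕ → Bool) :
    Summable fun i : ℕ => (if b i then 1 else 0) * (1 / 2 : ℝ) ^ (i + 1) := by
  refine Summable.of_nonneg_of_le (fun i => ?_) (fun i => ?_)
    ((summable_geometric_of_lt_one (by norm_num) (by norm_num : (1 / 2 : ℝ) < 1)).mul_left (1 / 2))
  · split_ifs <;> positivity
  · rw [pow_succ']
    split_ifs
    · rw [one_mul]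
    · rw [zero_mul]; positivity

theorem tsum_half_pow_succ : ∑' i : ℕ, (1 / 2 : ℝ) ^ (i + 1) = 1 := by
  simp only [pow_succ']
  rw [tsum_mul_left, tsum_geometric_of_lt_one (by norm_num) (by norm_num)]
  norm_num

theorem binaryReal_compl (b : ℕ → Bool) : binaryReal (fun i => !b i) = 1 - binaryReal b := by
  rw [eq_sub_iff_add_eq, binaryReal, binaryReal,
    ← (summable_binaryReal _).tsum_add (summable_binaryReal b)]
  refine (tsum_congr fun i => ?_).trans tsum_half_pow_succ
  cases b i <;> simp

theorem binaryReal_nonneg (b : ℕ → Bool) : 0 ≤ binaryReal b :=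
  tsum_nonneg fun i => by split_ifs <;> positivity

theorem binaryReal_le_one (b : ℕ → Bool) : binaryReal b ≤ 1 := by
  have := binaryReal_nonneg fun i => !b i
  rw [binaryReal_compl] at this
  linarith

theorem two_pow_mul_binaryReal (b : ℕ → Bool) (L : ℕ) :
    2 ^ L * binaryReal b = blockVal b L + binaryReal fun i => b (L + i) := by
  induction L with
  | zero => simp [blockVal]
  | succ L ih =>
    have h : 2 * binaryReal (fun i => b (L + i)) =
        ((b L).toNat : ℝ) + binaryReal fun i => b (L + 1 + i) := by
      rw [binaryReal, (summable_binaryReal fun i => b (L + i)).tsum_eq_zero_add,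
        mul_add, binaryReal, ← tsum_mul_left]
      congr 1
      · cases b L <;> simp
      · refine tsum_congr fun i => ?_
        rw [show L + (i + 1) = L + 1 + i by ring, pow_succ]
        ring
    rw [pow_succ', mul_assoc, ih, blockVal, mul_add, h]
    push_cast
    ring

theorem blockVal_le_mul_binaryReal (b : ℕ → Bool) (L : ℕ) :
    (blockVal b L : ℝ) ≤ 2 ^ L * binaryReal b := by
  rw [two_pow_mul_binaryReal]
  linarith [binaryReal_nonneg fun i => b (L + i)]

theorem mul_binaryReal_le_blockVal_add_one (b : ℕ → Bool) (L : ℕ) :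
    2 ^ L * binaryReal b ≤ blockVal b L + 1 := by
  rw [two_pow_mul_binaryReal]
  linarith [binaryReal_le_one fun i => b (L + i)]

/-- The increment of `g` on the `v`-th dyadic interval of level `L`. -/
noncomputable def increment (L v : ℕ) : ℝ := g ((v + 1 : ℕ) / 2 ^ L) - g (v / 2 ^ L)

/-- An odd step function approximating `g`, as a combination of tail signs. -/
noncomputable def stepG (L k : ℕ) : ℝ :=
  ∑ v ∈ Finset.Ico 1 (2 ^ (L - 1)), increment L v * tailSign (2 ^ L) v k

theorem stepG_compl {L k k' : ℕ} (h : k' + k + 1 = 2 ^ L) : stepG L k' = -stepG L k := by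
  simp only [stepG, tailSign_compl _ h]
  push_cast
  simp

theorem increment_nonneg {L v : ℕ} (hL : 1 ≤ L) (hv : v ∈ Finset.Ico 1 (2 ^ (L - 1))) :
    0 ≤ increment L v := by
  rw [Finset.mem_Ico] at hv
  have h1 : 2 ^ L = 2 * 2 ^ (L - 1) := by rw [← pow_succ']; congr 1; omega
  have h2 : ((v + 1 : ℕ) : ℝ) < 2 ^ L := by exact_mod_cast (by omega : v + 1 < 2 ^ L)
  refine sub_nonneg.2 (g_le_g ?_ ?_ ?_)
  · have : 0 < v := by omega
    positivity
  · push_cast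
    gcongr
    linarith
  · rw [div_lt_one (by positivity)]
    exact h2

theorem two_pow_pred_div {L : ℕ} (hL : 1 ≤ L) : ((2 ^ (L - 1) : ℕ) : ℝ) / 2 ^ L = 1 / 2 := by
  obtain ⟨j, rfl⟩ := Nat.exists_eq_add_of_le' hL
  rw [Nat.add_sub_cancel, pow_succ]
  push_cast
  field_simp

theorem sum_increment {L j : ℕ} (hL : 1 ≤ L) (hj : j ≤ 2 ^ (L - 1)) :
    ∑ v ∈ Finset.Ico j (2 ^ (L - 1)), increment L v = -g (j / 2 ^ L) := by
  unfold increment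
  rw [Finset.sum_Ico_sub (fun v : ℕ => g (v / 2 ^ L)) hj, two_pow_pred_div hL, g_half, zero_sub]

theorem stepG_of_lt {L k : ℕ} (hL : 1 ≤ L) (hk : k < 2 ^ (L - 1)) :
    stepG L k = g ((k + 1 : ℕ) / 2 ^ L) := by
  have h1 : 2 ^ L = 2 * 2 ^ (L - 1) := by rw [← pow_succ']; congr 1; omega
  rw [stepG, ← Finset.sum_Ico_consecutive _ (show 1 ≤ k + 1 by omega) (show k + 1 ≤ _ from hk)]
  have h2 : ∑ v ∈ Finset.Ico 1 (k + 1), increment L v * (tailSign (2 ^ L) v k : ℝ) = 0 := by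
    refine Finset.sum_eq_zero fun v hv => ?_
    rw [Finset.mem_Ico] at hv
    have : tailSign (2 ^ L) v k = 0 := by
      rw [tailSign, if_neg (by omega), if_neg (by omega), sub_zero]
    rw [this, Int.cast_zero, mul_zero]
  have h3 : ∑ v ∈ Finset.Ico (k + 1) (2 ^ (L - 1)), increment L v * (tailSign (2 ^ L) v k : ℝ) =
      -∑ v ∈ Finset.Ico (k + 1) (2 ^ (L - 1)), increment L v := by
    rw [← Finset.sum_neg_distrib]
    refine Finset.sum_congr rfl fun v hv => ?_
    rw [Finset.mem_Ico] at hv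
    have : tailSign (2 ^ L) v k = -1 := by
      rw [tailSign, if_neg (by omega), if_pos (by omega)]; rfl
    rw [this]
    push_cast
    ring
  rw [h2, h3, sum_increment hL hk]
  ring

/-- `stepG` approximates `g` away from the ends. -/
theorem abs_g_sub_stepG_le {m : ℕ} (hm : 1 ≤ m) (b : ℕ → Bool)
    (h0 : 2 ^ m ≤ blockVal b (4 * m)) (h1 : blockVal b (4 * m) + 2 ^ m < 2 ^ (4 * m)) :
    |g (binaryReal b) - stepG (4 * m) (blockVal b (4 * m))| ≤ 3 * (1 / 2) ^ m := by
  have hpp : (2 : ℝ) ^ (4 * m) = 2 ^ (3 * m) * 2 ^ m := by rw [← pow_add]; congr 1; ring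
  have main : ∀ b : ℕ → Bool, 2 ^ m ≤ blockVal b (4 * m) → blockVal b (4 * m) < 2 ^ (4 * m - 1) →
      |g (binaryReal b) - stepG (4 * m) (blockVal b (4 * m))| ≤ 3 * (1 / 2) ^ m := by
    intro b h0 hk
    rw [stepG_of_lt (by omega) hk, abs_sub_comm]
    have hK : (0 : ℝ) < 2 ^ (4 * m) := by positivity
    have hp : (1 : ℝ) / 2 ^ (3 * m) ≤ binaryReal b := by
      have h2 := blockVal_le_mul_binaryReal b (4 * m)
      have h3 : (2 : ℝ) ^ m ≤ blockVal b (4 * m) := by exact_mod_cast h0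
      rw [div_le_iff₀ (by positivity)]
      have h4 : (2 : ℝ) ^ m * 1 ≤ 2 ^ m * (binaryReal b * 2 ^ (3 * m)) := by
        rw [hpp] at h2
        linarith
      exact le_of_mul_le_mul_left h4 (by positivity)
    have hle : binaryReal b ≤ ((blockVal b (4 * m) + 1 : ℕ) : ℝ) / 2 ^ (4 * m) := by
      rw [le_div_iff₀ hK, mul_comm]
      exact_mod_cast mul_binaryReal_le_blockVal_add_one b (4 * m)
    have hle' : ((blockVal b (4 * m) + 1 : ℕ) : ℝ) / 2 ^ (4 * m) ≤ 1 / 2 := by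
      rw [← two_pow_pred_div (show 1 ≤ 4 * m by omega)]
      gcongr
      exact hk
    have hp2 : (1 : ℝ) / 2 ^ (3 * m) ≤ 1 / 2 := by linarith
    have h5 := g_sub_g_le (by positivity) hp hle (by linarith)
    have h6 : g (binaryReal b) ≤ g (((blockVal b (4 * m) + 1 : ℕ) : ℝ) / 2 ^ (4 * m)) :=
      g_le_g (lt_of_lt_of_le (by positivity) hp) hle (by linarith)
    rw [abs_of_nonneg (by linarith)]
    refine h5.trans ?_
    have h7 : ((blockVal b (4 * m) + 1 : ℕ) : ℝ) / 2 ^ (4 * m) - binaryReal b ≤ 1 / 2 ^ (4 * m) := by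
      rw [sub_le_iff_le_add, div_le_iff₀ hK, add_mul, one_div_mul_cancel hK.ne']
      push_cast
      linarith [blockVal_le_mul_binaryReal b (4 * m)]
    calc 3 / (1 / 2 ^ (3 * m)) * (((blockVal b (4 * m) + 1 : ℕ) : ℝ) / 2 ^ (4 * m) - binaryReal b)
        ≤ 3 / (1 / 2 ^ (3 * m)) * (1 / 2 ^ (4 * m)) := by gcongr
      _ = 3 * (1 / 2) ^ m := by
        rw [hpp, one_div, one_div, one_div, inv_pow]
        field_simp
  have hc := blockVal_compl_add b (4 * m)
  have h2 : 2 ^ (4 * m) = 2 * 2 ^ (4 * m - 1) := by rw [← pow_succ']; congr 1; omega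
  by_cases hk : blockVal b (4 * m) < 2 ^ (4 * m - 1)
  · exact main b h0 hk
  · have h3 := main (fun i => !b i) (by omega) (by omega)
    rw [binaryReal_compl, g_one_sub ?_, stepG_compl hc] at h3
    · rwa [neg_sub_neg, abs_sub_comm] at h3
    · have h4 := blockVal_le_mul_binaryReal b (4 * m)
      have h5 := mul_binaryReal_le_blockVal_add_one b (4 * m)
      have hpos : 0 < 2 ^ m := Nat.two_pow_pos m
      have h6 : (0 : ℝ) < blockVal b (4 * m) := by exact_mod_cast lt_of_lt_of_le hpos h0
      have h7 : (blockVal b (4 * m) : ℝ) + 1 < 2 ^ (4 * m) := by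
        exact_mod_cast (by omega : blockVal b (4 * m) + 1 < 2 ^ (4 * m))
      have hK : (0 : ℝ) < 2 ^ (4 * m) := by positivity
      constructor
      · exact pos_of_mul_pos_right (h6.trans_le h4) hK.le
      · refine lt_of_mul_lt_mul_left ?_ hK.le
        rw [mul_one]
        linarith

end GaussianInverse

/-! ## Uniform convergence of the Fourier-Wiener series -/

section Convergence

open Filter Topology

theorem abs_sum_xi_mul_le {φ : ℕ × ℕ → ℕ} {α : ℕ → Bool} {m : ℕ} (hm : 1 ≤ m)
    (hbad : ¬ IsBad m (blockNum φ m α)) (hpow : (m : ℝ) ^ 16 * (1 / 2) ^ m ≤ 1) {c : ℕ}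
    (hc : c < 2) {M : ℕ} (hM : M ≤ m ^ 16) {e : ℕ → ℝ} (he : ∀ n, |e n| ≤ 1)
    (hs : ∀ v < 2 ^ (4 * m), |∑ n ∈ Finset.range M,
      (tailSign (2 ^ (4 * m)) v (blockNum φ m α (2 * n + c)) : ℝ) * e n| ≤ 2 * m ^ 13) :
    |∑ n ∈ Finset.range M, xi φ α (2 * n + c) * e n| ≤ 19 * m ^ 14 := by
  have hm1 : (1 : ℝ) ≤ m := by exact_mod_cast hm
  set κ := blockNum φ m α with hκ
  have h1 : |∑ n ∈ Finset.range M, (xi φ α (2 * n + c) - stepG (4 * m) (κ (2 * n + c))) * e n|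
      ≤ 3 := by
    calc _ ≤ ∑ n ∈ Finset.range M,
          |(xi φ α (2 * n + c) - stepG (4 * m) (κ (2 * n + c))) * e n| :=
          Finset.abs_sum_le_sum_abs _ _
      _ ≤ ∑ n ∈ Finset.range M, 3 * (1 / 2 : ℝ) ^ m := by
          refine Finset.sum_le_sum fun n hn => ?_
          rw [Finset.mem_range] at hn
          have hedge : ¬ (κ (2 * n + c) < 2 ^ m ∨ 2 ^ (4 * m) ≤ κ (2 * n + c) + 2 ^ m) :=
            fun h => hbad (Or.inl ⟨2 * n + c, by omega, h⟩)
          rw [not_or, not_lt, not_le] at hedge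
          rw [abs_mul]
          exact (mul_le_of_le_one_right (abs_nonneg _) (he n)).trans
            (abs_g_sub_stepG_le hm (fun i => α (φ (2 * n + c, i))) hedge.1 hedge.2)
      _ = M * (3 * (1 / 2 : ℝ) ^ m) := by simp
      _ ≤ (m : ℝ) ^ 16 * (3 * (1 / 2 : ℝ) ^ m) := by
          gcongr
          exact_mod_cast hM
      _ ≤ 3 := by linarith
  have h2 : |∑ n ∈ Finset.range M, stepG (4 * m) (κ (2 * n + c)) * e n| ≤ 16 * m ^ 14 := by
    have e1 : ∑ n ∈ Finset.range M, stepG (4 * m) (κ (2 * n + c)) * e n =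
        ∑ v ∈ Finset.Ico 1 (2 ^ (4 * m - 1)), increment (4 * m) v *
          ∑ n ∈ Finset.range M, (tailSign (2 ^ (4 * m)) v (κ (2 * n + c)) : ℝ) * e n := by
      simp only [stepG, Finset.sum_mul, Finset.mul_sum]
      rw [Finset.sum_comm]
      exact Finset.sum_congr rfl fun v _ => Finset.sum_congr rfl fun n _ => by ring
    rw [e1]
    calc _ ≤ ∑ v ∈ Finset.Ico 1 (2 ^ (4 * m - 1)), |increment (4 * m) v *
          ∑ n ∈ Finset.range M, (tailSign (2 ^ (4 * m)) v (κ (2 * n + c)) : ℝ) * e n| :=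
          Finset.abs_sum_le_sum_abs _ _
      _ ≤ ∑ v ∈ Finset.Ico 1 (2 ^ (4 * m - 1)), increment (4 * m) v * (2 * m ^ 13) := by
          refine Finset.sum_le_sum fun v hv => ?_
          have hv' := (Finset.mem_Ico.1 hv).2
          have hinc := increment_nonneg (L := 4 * m) (by omega) hv
          rw [abs_mul, abs_of_nonneg hinc]
          exact mul_le_mul_of_nonneg_left (hs v (hv'.trans_le
            (Nat.pow_le_pow_right (by norm_num) (Nat.sub_le _ _)))) hinc
      _ = -g (1 / 2 ^ (4 * m)) * (2 * m ^ 13) := by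
          rw [← Finset.sum_mul, sum_increment (by omega) Nat.one_le_two_pow, Nat.cast_one]
      _ ≤ (2 * (4 * m : ℕ)) * (2 * m ^ 13) := by
          gcongr
          exact (neg_le_abs _).trans (abs_g_two_pow_le (by omega))
      _ = 16 * m ^ 14 := by push_cast; ring
  have h3 : ∑ n ∈ Finset.range M, xi φ α (2 * n + c) * e n =
      ∑ n ∈ Finset.range M, (xi φ α (2 * n + c) - stepG (4 * m) (κ (2 * n + c))) * e n +
      ∑ n ∈ Finset.range M, stepG (4 * m) (κ (2 * n + c)) * e n := by
    rw [← Finset.sum_add_distrib]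
    exact Finset.sum_congr rfl fun n _ => by ring
  rw [h3]
  have h4 : (1 : ℝ) ≤ (m : ℝ) ^ 14 := one_le_pow₀ hm1
  exact (abs_add_le _ _).trans (by linarith)

/-- The trigonometric sums of the even and of the odd variables are `O(M ^ (7 / 8))`. -/
theorem eventually_abs_trigSum_xi_le {φ : ℕ × ℕ → ℕ} {α : ℕ → Bool}
    (h : ∀ᶠ m in atTop, ¬ IsBad m (blockNum φ m α)) :
    ∀ᶠ M : ℕ in atTop, ∀ c < 2, ∀ θ : ℝ,
      |∑ n ∈ Finset.range M, xi φ α (2 * n + c) * Real.cos (n * θ)| ≤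
        19 * 2 ^ 14 * (M : ℝ) ^ (7 / 8 : ℝ) ∧
      |∑ n ∈ Finset.range M, xi φ α (2 * n + c) * Real.sin (n * θ)| ≤
        19 * 2 ^ 14 * (M : ℝ) ^ (7 / 8 : ℝ) := by
  have hpow := (tendsto_pow_const_mul_const_pow_of_abs_lt_one 16
    (show |(1 / 2 : ℝ)| < 1 by norm_num [abs_of_pos])).eventually (ge_mem_nhds one_pos)
  have hlevel : Tendsto (fun M : ℕ => ⌈(M : ℝ) ^ (1 / 16 : ℝ)⌉₊) atTop atTop :=
    tendsto_nat_ceil_atTop.comp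
      ((tendsto_rpow_atTop (by norm_num)).comp tendsto_natCast_atTop_atTop)
  filter_upwards [hlevel.eventually (h.and (hpow.and (eventually_ge_atTop 1))),
    eventually_ge_atTop 1] with M hM hM1 c hc θ
  obtain ⟨hbad, hp, hm⟩ := hM
  set m := ⌈(M : ℝ) ^ (1 / 16 : ℝ)⌉₊ with hmdef
  have hM0 : (0 : ℝ) ≤ M := Nat.cast_nonneg M
  have hroot : (M : ℝ) ^ (1 / 16 : ℝ) ≤ m := Nat.le_ceil _
  have hMm : M ≤ m ^ 16 := by
    have h1 : ((M : ℝ) ^ (1 / 16 : ℝ)) ^ 16 ≤ (m : ℝ) ^ 16 :=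
      pow_le_pow_left₀ (by positivity) hroot 16
    rw [← Real.rpow_natCast, ← Real.rpow_mul hM0] at h1
    norm_num at h1
    exact_mod_cast h1
  have hbound : 19 * (m : ℝ) ^ 14 ≤ 19 * 2 ^ 14 * (M : ℝ) ^ (7 / 8 : ℝ) := by
    have h1 : (1 : ℝ) ≤ (M : ℝ) ^ (1 / 16 : ℝ) :=
      Real.one_le_rpow (by exact_mod_cast hM1) (by norm_num)
    have h2 : (m : ℝ) ≤ 2 * (M : ℝ) ^ (1 / 16 : ℝ) := by
      have := (Nat.ceil_lt_add_one (show (0 : ℝ) ≤ (M : ℝ) ^ (1 / 16 : ℝ) by positivity)).le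
      linarith
    have h3 : (m : ℝ) ^ 14 ≤ (2 * (M : ℝ) ^ (1 / 16 : ℝ)) ^ 14 :=
      pow_le_pow_left₀ (Nat.cast_nonneg m) h2 14
    have h4 : ((M : ℝ) ^ (1 / 16 : ℝ)) ^ 14 = (M : ℝ) ^ (7 / 8 : ℝ) := by
      rw [← Real.rpow_natCast, ← Real.rpow_mul hM0]
      norm_num
    rw [mul_pow, h4] at h3
    linarith
  constructor
  · exact (abs_sum_xi_mul_le hm hbad hp hc hMm (fun n => Real.abs_cos_le_one _)
      fun v hv => (abs_sum_tailSign_le hm hbad hc hv θ hMm).1).trans hbound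
  · exact (abs_sum_xi_mul_le hm hbad hp hc hMm (fun n => Real.abs_sin_le_one _)
      fun v hv => (abs_sum_tailSign_le hm hbad hc hv θ hMm).2).trans hbound

/-- Abel summation. -/
theorem sum_one_div_mul_eq (a : ℕ → ℝ) (h0 : a 0 = 0) (N : ℕ) :
    ∑ n ∈ Finset.Icc 1 N, 1 / (n : ℝ) * a n =
      (∑ k ∈ Finset.range (N + 1), a k) / ((N : ℝ) + 1) +
      ∑ n ∈ Finset.range N, (∑ k ∈ Finset.range (n + 2), a k) / (((n : ℝ) + 1) * (n + 2)) := by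
  induction N with
  | zero => simp [h0]
  | succ N ih =>
    rw [Finset.sum_Icc_succ_top (by omega), ih,
      Finset.sum_range_succ (fun n : ℕ => (∑ k ∈ Finset.range (n + 2), a k) / _) N,
      Finset.sum_range_succ a (N + 1)]
    generalize ∑ k ∈ Finset.range (N + 1), a k = S
    generalize ∑ n ∈ Finset.range N, (∑ k ∈ Finset.range (n + 2), a k) / _ = T
    have h1 : (N : ℝ) + 1 ≠ 0 := by positivity
    have h2 : (N : ℝ) + 2 ≠ 0 := by positivity
    have h3 : (N : ℝ) + 1 + 1 ≠ 0 := by positivity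
    push_cast
    field_simp
    ring

/-- If the partial sums of a family of functions are `O(M ^ (7 / 8))`, then the series with the
terms divided by `n` converges uniformly. -/
theorem exists_tendstoUniformlyOn_sum_one_div_mul {a : ℕ → ℝ → ℝ} {s : Set ℝ} {C : ℝ}
    (hC : 0 ≤ C) (h0 : ∀ t, a 0 t = 0)
    (ha : ∀ᶠ M : ℕ in atTop, ∀ t ∈ s, |∑ n ∈ Finset.range M, a n t| ≤ C * (M : ℝ) ^ (7 / 8 : ℝ)) :
    ∃ W : ℝ → ℝ, TendstoUniformlyOn
      (fun (N : ℕ) t => ∑ n ∈ Finset.Icc 1 N, 1 / (n : ℝ) * a n t) W atTop s := by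
  have hdiv : ∀ M : ℕ, 1 ≤ M → C * (M : ℝ) ^ (7 / 8 : ℝ) / M = C * (M : ℝ) ^ (-(1 / 8) : ℝ) := by
    intro M hM
    have hM0 : (0 : ℝ) < M := by exact_mod_cast hM
    rw [mul_div_assoc]
    congr 1
    nth_rw 2 [← Real.rpow_one (M : ℝ)]
    rw [← Real.rpow_sub hM0]
    norm_num
  have hfst : TendstoUniformlyOn (fun (N : ℕ) t =>
      (∑ k ∈ Finset.range (N + 1), a k t) / ((N : ℝ) + 1)) (fun _ => 0) atTop s := by
    rw [Metric.tendstoUniformlyOn_iff]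
    intro ε hε
    have hlim : Tendsto (fun M : ℕ => C * (M : ℝ) ^ (-(1 / 8) : ℝ)) atTop (𝓝 0) := by
      have := ((tendsto_rpow_neg_atTop (show (0 : ℝ) < 1 / 8 by norm_num)).comp
        tendsto_natCast_atTop_atTop).const_mul C
      rwa [mul_zero] at this
    have hev := (tendsto_add_atTop_nat 1).eventually
      (ha.and ((hlim.eventually (gt_mem_nhds hε)).and (eventually_ge_atTop 1)))
    filter_upwards [hev] with N hN t ht
    obtain ⟨hN1, hN2, hN3⟩ := hN
    have hpos : (0 : ℝ) < (N : ℝ) + 1 := by positivity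
    rw [dist_zero_left, Real.norm_eq_abs, abs_div, abs_of_pos hpos]
    refine lt_of_le_of_lt ?_ hN2
    rw [← hdiv _ hN3]
    push_cast at hN1 ⊢
    gcongr
    exact hN1 t ht
  have hsum : Summable fun n : ℕ => C * ((n + 1 : ℕ) : ℝ) ^ (-(9 / 8) : ℝ) :=
    ((summable_nat_add_iff 1).2 (Real.summable_nat_rpow.2 (by norm_num))).mul_left C
  have hsnd := tendstoUniformlyOn_tsum_nat_eventually (s := s)
    (f := fun n t => (∑ k ∈ Finset.range (n + 2), a k t) / (((n : ℝ) + 1) * (n + 2))) hsum (by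
      filter_upwards [(tendsto_add_atTop_nat 2).eventually ha] with n hn t ht
      have h1 : (0 : ℝ) < (n : ℝ) + 1 := by positivity
      have h2 : (0 : ℝ) < (n : ℝ) + 2 := by positivity
      have hd := hdiv (n + 2) (by omega)
      rw [Real.norm_eq_abs, abs_div, abs_of_pos (mul_pos h1 h2)]
      calc |∑ k ∈ Finset.range (n + 2), a k t| / (((n : ℝ) + 1) * (n + 2))
          ≤ C * ((n + 2 : ℕ) : ℝ) ^ (7 / 8 : ℝ) / (((n : ℝ) + 1) * (n + 2)) := by
            gcongr
            exact hn t ht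
        _ = C * ((n + 2 : ℕ) : ℝ) ^ (7 / 8 : ℝ) / ((n + 2 : ℕ) : ℝ) / ((n : ℝ) + 1) := by
            push_cast
            rw [div_div, mul_comm ((n : ℝ) + 1)]
        _ = C * ((n + 2 : ℕ) : ℝ) ^ (-(1 / 8) : ℝ) / ((n : ℝ) + 1) := by rw [hd]
        _ ≤ C * ((n + 1 : ℕ) : ℝ) ^ (-(1 / 8) : ℝ) / ((n : ℝ) + 1) := by
            gcongr C * ?_ / _
            refine Real.rpow_le_rpow_of_nonpos (by push_cast; exact h1) ?_ (by norm_num)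
            push_cast
            linarith
        _ = C * ((n + 1 : ℕ) : ℝ) ^ (-(9 / 8) : ℝ) := by
            push_cast
            rw [mul_div_assoc]
            congr 1
            nth_rw 2 [← Real.rpow_one ((n : ℝ) + 1)]
            rw [← Real.rpow_sub h1]
            norm_num)
  refine ⟨_, (hfst.add hsnd).congr (Eventually.of_forall fun N t _ => ?_)⟩
  exact (sum_one_div_mul_eq (fun n => a n t) (h0 t) N).symm

theorem fourierWienerSum_eq (φ : ℕ × ℕ → ℕ) (α : ℕ → Bool) (N : ℕ) (t : ℝ) :
    fourierWienerSum φ α N t = X φ α 0 * t + Real.sqrt 2 / (2 * Real.pi) *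
      ∑ n ∈ Finset.Icc 1 N, 1 / (n : ℝ) * (X φ α n * Real.sin (2 * Real.pi * n * t) +
        Y φ α n * (1 - Real.cos (2 * Real.pi * n * t))) := by
  rw [fourierWienerSum, Finset.mul_sum, Finset.mul_sum]
  congr 1
  refine Finset.sum_congr rfl fun n _ => ?_
  rw [one_div_mul_eq_div, ← div_div]
  ring

theorem continuous_fourierWienerSum (φ : ℕ × ℕ → ℕ) (α : ℕ → Bool) (N : ℕ) :
    Continuous (fourierWienerSum φ α N) := by
  unfold fourierWienerSum
  fun_prop

theorem exists_tendstoUniformlyOn_fourierWienerSum {φ : ℕ × ℕ → ℕ} {α : ℕ → Bool}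
    (h : ∀ᶠ m in atTop, ¬ IsBad m (blockNum φ m α)) :
    ∃ W : ℝ → ℝ, ContinuousOn W (Set.Icc 0 1) ∧
      TendstoUniformlyOn (fun (N : ℕ) (t : ℝ) => fourierWienerSum φ α N t) W atTop
        (Set.Icc 0 1) := by
  obtain ⟨V, hV⟩ := exists_tendstoUniformlyOn_sum_one_div_mul (s := Set.Icc 0 1)
    (a := fun n t => X φ α n * Real.sin (2 * Real.pi * n * t) +
      Y φ α n * (1 - Real.cos (2 * Real.pi * n * t))) (C := 3 * (19 * 2 ^ 14)) (by norm_num)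
    (by simp) (by
      filter_upwards [eventually_abs_trigSum_xi_le h] with M hM t _
      have e1 := (hM 0 (by norm_num) (2 * Real.pi * t)).2
      have e2 := (hM 1 (by norm_num) 0).1
      have e3 := (hM 1 (by norm_num) (2 * Real.pi * t)).1
      have e4 : ∑ n ∈ Finset.range M, (X φ α n * Real.sin (2 * Real.pi * n * t) +
          Y φ α n * (1 - Real.cos (2 * Real.pi * n * t))) =
          ∑ n ∈ Finset.range M, xi φ α (2 * n + 0) * Real.sin (n * (2 * Real.pi * t)) +
          (∑ n ∈ Finset.range M, xi φ α (2 * n + 1) * Real.cos (n * 0) -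
          ∑ n ∈ Finset.range M, xi φ α (2 * n + 1) * Real.cos (n * (2 * Real.pi * t))) := by
        rw [← Finset.sum_sub_distrib, ← Finset.sum_add_distrib]
        refine Finset.sum_congr rfl fun n _ => ?_
        rw [show 2 * Real.pi * n * t = n * (2 * Real.pi * t) by ring, mul_zero, Real.cos_zero]
        simp only [X, Y, add_zero]
        ring
      rw [e4]
      refine (abs_add_le _ _).trans ?_
      have e5 := abs_sub
        (∑ n ∈ Finset.range M, xi φ α (2 * n + 1) * Real.cos (n * 0))
        (∑ n ∈ Finset.range M, xi φ α (2 * n + 1) * Real.cos (n * (2 * Real.pi * t)))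
      linarith)
  have hW : TendstoUniformlyOn (fun (N : ℕ) (t : ℝ) => fourierWienerSum φ α N t)
      (fun t => X φ α 0 * t + Real.sqrt 2 / (2 * Real.pi) * V t) atTop (Set.Icc 0 1) := by
    have h1 : TendstoUniformlyOn (fun (_ : ℕ) (t : ℝ) => X φ α 0 * t) (fun t => X φ α 0 * t) atTop
        (Set.Icc 0 1) := by
      rw [Metric.tendstoUniformlyOn_iff]
      exact fun ε hε => Eventually.of_forall fun _ _ _ => by rwa [dist_self]
    have h2 := (uniformContinuous_const_smul (Real.sqrt 2 / (2 * Real.pi)) :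
      UniformContinuous fun x : ℝ => _).comp_tendstoUniformlyOn hV
    exact (h1.add h2).congr (Eventually.of_forall fun N t _ => (fourierWienerSum_eq φ α N t).symm)
  exact ⟨_, hW.continuousOn (Eventually.of_forall fun N =>
    (continuous_fourierWienerSum φ α N).continuousOn).frequently, hW⟩

end Convergence

end KCFourier

theorem mainTheorem2 (U : List Bool →. List Bool) (hU : KCFourier.IsOptimalMachine U)
    (φ : ℕ × ℕ → ℕ) (hφ : Computable φ) (hφ_bij : Function.Bijective φ)
    (α : ℕ → Bool) (hα : α ∈ KCFourier.KC U) :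
    ∃ W : ℝ → ℝ, ContinuousOn W (Set.Icc 0 1) ∧
      TendstoUniformlyOn (fun (N : ℕ) (t : ℝ) => KCFourier.fourierWienerSum φ α N t) W
        Filter.atTop (Set.Icc 0 1) :=
  KCFourier.exists_tendstoUniformlyOn_fourierWienerSum
    (KCFourier.eventually_not_isBad hU hφ hφ_bij.injective hα)
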